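/- Fix an integer $k\ge 2$. Let $\mathbb N$ be the structure $(\mathbb N,0,S,+,V_k,\le)$, where $S(x)=x+1$, $V_k(0)=0$ and, for $x>0$, $V_k(x)$ is the largest power of $k$ dividing $x$. Let $\mathsf{BA}_k$ (Büchi arithmetic) be the set of all first-order sentences of the language $(0,S,+,V_k,\le)$ (with equality) that are true in $\mathbb N$. Notation: $x<y$ stands for $x\le y\wedge x\ne y$; $\underline n$ is the term $S(\dots S(0)\dots)$ with $n$ occurrences of $S$; $nt$ is the term $t+(t+(\dots(t+0)))$ with $n$ occurrences of $t$. A formula is $\Delta_0$ if all its quantifiers are of the form $\exists x\le t$ or $\forall x\le t$, where $x$ does not occur in the term $t$; it is $\Pi_1$ if it is of the form $\forall\vec x\,\theta$ with $\theta\in\Delta_0$. Bounded quantifiers with $<$ abbreviate the corresponding ones with $\le$. Put $$P_k(d):\iff d>0\wedge V_k(d)=d,\qquad x\equiv_k y:\iff \exists z\le x+y\,(x=y+kz\vee y=x+kz),$$ $$(x)_d=a:\iff P_k(d)\wedge\exists y<d\ \exists z\le x\,\bigl(x=y+ad+z\wedge(z=0\vee V_k(z)>d)\bigr)\quad(0\le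 a<k).$$ Let $\mathsf T_k$ be the theory consisting of the universal closures of the following formulas. - (Add) the axioms of discretely ordered commutative cancellative monoids: $(x+y)+z=x+(y+z)$; $x+y=y+x$; $x+0=x$; $x+z=y+z\to x=y$; $\le$ is a linear order (reflexive, antisymmetric, transitive, total); $x\le y\to x+z\le y+z$; $S(x)=x+\underline 1$; $x<y\leftrightarrow S(x)\le y$. - (Ord0) $x\ge 0$. - (Ord1) $x\le y\leftrightarrow\exists z\le y\,(z+x=y)$. - (Mod) $\bigvee_{a=0}^{k-1}x\equiv_k\underline a$. - (V0) $V_k(0)=0$; $V_k(\underline 1)=\underline 1$. - (V1) $V_k(kx)=kV_k(x)$; $P_k(d)\to\bigwedge_{a=1}^{k-1}V_k(ad)=d$. - (V2) $(x>0\wedge y>0\wedge V_k(x)<V_k(y))\to V_k(x+y)=V_k(x)$. - (V3) $x>0\to\exists y\le x\ \bigvee_{a=1}^{k-1}\bigl(x=y+aV_k(x)\wedge(V_k(y)>V_k(x)\vee y=0)\bigr)$. - (V4) $x>0\to\exists d\le x\,(P_k(d)\wedge d\le x\wedge x<kd)$. - (V5) $V_k(V_k(x))=V_k(x)$. - (Comp)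 $P_k(d)\to\exists x<d\ \forall d'<d\,\Bigl(P_k(d')\to\bigl((x)_{d'}=1\wedge\varphi(d',\vec y)\bigr)\vee\bigl((x)_{d'}=0\wedge\neg\varphi(d',\vec y)\bigr)\Bigr)$, for every $\Delta_0$-formula $\varphi(d,\vec y)$. **Theorem.** $\mathsf T_k$ axiomatizes $\mathsf{BA}_k$: a sentence is true in $\mathbb N$ if and only if it is a logical consequence of $\mathsf T_k$ in first-order logic (that is, true in all models of $\mathsf T_k$). In particular, $\mathsf{BA}_k$ admits a $\Pi_1$-axiomatization: there is a set of $\Pi_1$-sentences whose logical consequences are exactly the members of $\mathsf{BA}_k$. -/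

import Mathlib

namespace BuchiArithmetic

open FirstOrder FirstOrder.Language

/-- Function symbols of the language of Büchi arithmetic: `0`, `S`, `+`, `V_k`. -/
inductive Func : ℕ → Type
  | zero : Func 0
  | succ : Func 1
  | add : Func 2
  | V : Func 1

/-- The only relation symbol of the language of Büchi arithmetic: `≤`. -/
inductive Rel : ℕ → Type
  | le : Rel 2

/-- The first-order language with signature `(0, S, +, V_k, ≤)`; equality is logical. -/
def LBA : FirstOrder.Language.{0, 0} := ⟨Func, Rel⟩

/-! ### The standard model -/

/-- `V_k(x)`: the largest power of `k` dividing `x` for `x > 0`, and `V_k(0) = 0`. -/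
noncomputable def vVal (k x : ℕ) : ℕ := if x = 0 then 0 else k ^ multiplicity k x

theorem vVal_zero (k : ℕ) : vVal k 0 = 0 := if_pos rfl

/-- For a base `k ≥ 2` and `x > 0`, `vVal k x` is the greatest power of `k` dividing `x`. -/
theorem isGreatest_vVal {k x : ℕ} (hk : 2 ≤ k) (hx : 0 < x) :
    IsGreatest {d : ℕ | (∃ n : ℕ, d = k ^ n) ∧ d ∣ x} (vVal k x) := by
  have hv : vVal k x = k ^ multiplicity k x := if_neg hx.ne'
  have hfin : FiniteMultiplicity k x := Nat.finiteMultiplicity_iff.2 ⟨by omega, hx⟩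
  rw [hv]
  refine ⟨⟨⟨_, rfl⟩, pow_multiplicity_dvd k x⟩, ?_⟩
  rintro d ⟨⟨n, rfl⟩, hd⟩
  exact Nat.pow_le_pow_right (by omega) (hfin.le_multiplicity_of_pow_dvd hd)

/-- The set `ℕ` regarded as the universe of the standard model of base-`k` Büchi arithmetic. -/
def Std (_k : ℕ) : Type := ℕ

/-- The standard structure `(ℕ, 0, S, +, V_k, ≤)`. -/
noncomputable instance stdStructure (k : ℕ) : LBA.Structure (Std k) where
  funMap {_} f :=
    match f with
    | Func.zero => fun _ => (0 : ℕ)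
    | Func.succ => fun v => Nat.succ (v 0)
    | Func.add => fun v => Nat.add (v 0) (v 1)
    | Func.V => fun v => vVal k (v 0)
  RelMap {_} r :=
    match r with
    | Rel.le => fun v => Nat.le (v 0) (v 1)

/-- Büchi arithmetic `BA_k`: the set of all sentences true in `(ℕ, 0, S, +, V_k, ≤)`. -/
def BA (k : ℕ) : LBA.Theory := LBA.completeTheory (Std k)

/-! ### Terms -/

section Terms

variable {β : Type}

/-- The term `0`. -/
def zero : LBA.Term β := Term.func Func.zero ![]

/-- The term `S(t)`. -/
def succ (t : LBA.Term β) : LBA.Term β := Term.func Func.succ ![t]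

/-- The term `s + t`. -/
def add (s t : LBA.Term β) : LBA.Term β := Term.func Func.add ![s, t]

/-- The term `V_k(t)`. -/
def V (t : LBA.Term β) : LBA.Term β := Term.func Func.V ![t]

/-- The numeral `S(S(… S(0) …))` with `n` occurrences of `S`. -/
def numeral : ℕ → LBA.Term β
  | 0 => zero
  | n + 1 => succ (numeral n)

/-- The term `n t = t + (t + (… (t + 0) …))` with `n` occurrences of `t`. -/
def mul : ℕ → LBA.Term β → LBA.Term β
  | 0, _ => zero
  | n + 1, t => add t (mul n t)

end Terms

/-! ### Formulas

A formula in `LBA.BoundedFormula α n` has free variables in `α` and the variables `&0, …, &(n-1)`;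
a quantifier in front of a formula with `n + 1` such variables binds `&n`. -/

section Formulas

variable {α : Type} {n : ℕ}

/-- The term `t`, regarded as a term over one more variable (which does not occur in it). -/
def lift (t : LBA.Term (α ⊕ Fin n)) : LBA.Term (α ⊕ Fin (n + 1)) :=
  t.relabel (Sum.map id Fin.castSucc)

/-- The variable bound by a quantifier in front of a formula with `n + 1` variables. -/
def top (α : Type) (n : ℕ) : LBA.Term (α ⊕ Fin (n + 1)) := Term.var (Sum.inr (Fin.last n))

/-- `s ≤ t` -/
def le (s t : LBA.Term (α ⊕ Fin n)) : LBA.BoundedFormula α n :=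
  BoundedFormula.rel Rel.le ![s, t]

/-- `s < t`, i.e. `s ≤ t ∧ s ≠ t` -/
def lt (s t : LBA.Term (α ⊕ Fin n)) : LBA.BoundedFormula α n :=
  le s t ⊓ ∼(s =' t)

/-- `∀ x ≤ t φ`, where `x` does not occur in `t` -/
def ballLe (t : LBA.Term (α ⊕ Fin n)) (φ : LBA.BoundedFormula α (n + 1)) :
    LBA.BoundedFormula α n :=
  ∀' (le (top α n) (lift t) ⟹ φ)

/-- `∃ x ≤ t φ`, where `x` does not occur in `t` -/
def bexLe (t : LBA.Term (α ⊕ Fin n)) (φ : LBA.BoundedFormula α (n + 1)) :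
    LBA.BoundedFormula α n :=
  ∃' (le (top α n) (lift t) ⊓ φ)

/-- `∀ x < t φ`, i.e. `∀ x ≤ t (x < t → φ)` -/
def ballLt (t : LBA.Term (α ⊕ Fin n)) (φ : LBA.BoundedFormula α (n + 1)) :
    LBA.BoundedFormula α n :=
  ballLe t (lt (top α n) (lift t) ⟹ φ)

/-- `∃ x < t φ`, i.e. `∃ x ≤ t (x < t ∧ φ)` -/
def bexLt (t : LBA.Term (α ⊕ Fin n)) (φ : LBA.BoundedFormula α (n + 1)) :
    LBA.BoundedFormula α n :=
  bexLe t (lt (top α n) (lift t) ⊓ φ)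

/-- The bounded (`Δ₀`) formulas: all quantifiers are of the form `∀ x ≤ t` or `∃ x ≤ t`, where `x`
does not occur in `t`. The connectives `¬`, `∧`, `∨`, `↔` are built from `→` and `⊥`. -/
inductive IsDelta0 {α : Type} : ∀ {n : ℕ}, LBA.BoundedFormula α n → Prop
  | falsum {n : ℕ} : IsDelta0 (BoundedFormula.falsum : LBA.BoundedFormula α n)
  | equal {n : ℕ} (s t : LBA.Term (α ⊕ Fin n)) : IsDelta0 (BoundedFormula.equal s t)
  | rel {n l : ℕ} (R : LBA.Relations l) (ts : Fin l → LBA.Term (α ⊕ Fin n)) :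
      IsDelta0 (BoundedFormula.rel R ts)
  | imp {n : ℕ} {φ ψ : LBA.BoundedFormula α n} :
      IsDelta0 φ → IsDelta0 ψ → IsDelta0 (φ.imp ψ)
  | ballLe {n : ℕ} (t : LBA.Term (α ⊕ Fin n)) {φ : LBA.BoundedFormula α (n + 1)} :
      IsDelta0 φ → IsDelta0 (ballLe t φ)
  | bexLe {n : ℕ} (t : LBA.Term (α ⊕ Fin n)) {φ : LBA.BoundedFormula α (n + 1)} :
      IsDelta0 φ → IsDelta0 (bexLe t φ)

/-- The `Π₁` formulas: those of the form `∀ x₁ … ∀ xₙ θ` with `θ` a `Δ₀` formula. -/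
def IsPi1 (φ : LBA.Formula α) : Prop :=
  ∃ (n : ℕ) (θ : LBA.BoundedFormula α n), IsDelta0 θ ∧ φ = θ.alls

/-- The disjunction `⋁_{a ∈ l} f a` -/
def disj (l : List ℕ) (f : ℕ → LBA.BoundedFormula α n) : LBA.BoundedFormula α n :=
  (l.map f).foldr (· ⊔ ·) ⊥

/-- The conjunction `⋀_{a ∈ l} f a` -/
def conj (l : List ℕ) (f : ℕ → LBA.BoundedFormula α n) : LBA.BoundedFormula α n :=
  (l.map f).foldr (· ⊓ ·) ⊤

/-- `P_k(d)`, i.e. `d > 0 ∧ V_k(d) = d` -/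
def isPow (d : LBA.Term (α ⊕ Fin n)) : LBA.BoundedFormula α n :=
  lt zero d ⊓ (V d =' d)

/-- `x ≡_k y`, i.e. `∃ z ≤ x + y (x = y + kz ∨ y = x + kz)` -/
def modEq (k : ℕ) (x y : LBA.Term (α ⊕ Fin n)) : LBA.BoundedFormula α n :=
  bexLe (add x y)
    ((lift x =' add (lift y) (mul k (top α n))) ⊔ (lift y =' add (lift x) (mul k (top α n))))

/-- `(x)_d = a`, i.e.
`P_k(d) ∧ ∃ y < d ∃ z ≤ x (x = y + ad + z ∧ (z = 0 ∨ V_k(z) > d))` -/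
def digitEq (x d : LBA.Term (α ⊕ Fin n)) (a : ℕ) : LBA.BoundedFormula α n :=
  isPow d ⊓
    bexLt d
      (bexLe (lift x)
        ((lift (lift x) =' add (add (lift (top α n)) (mul a (lift (lift d)))) (top α (n + 1))) ⊓
          ((top α (n + 1) =' zero) ⊔ lt (lift (lift d)) (V (top α (n + 1))))))

end Formulas

/-! ### The theory `T_k` -/

/-- The comprehension axiom for `φ(d, y₀, …, yₙ₋₁)`; the free variable `0` of `φ` is `d`, the free
variable `i + 1` is `yᵢ`. It is the universal closure of
`P_k(d) → ∃ x < d ∀ d' < d (P_k(d') →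
  ((x)_{d'} = 1 ∧ φ(d', y)) ∨ ((x)_{d'} = 0 ∧ ¬ φ(d', y)))`,
where `yᵢ` is `&i` for `i < n`, `d` is `&n`, `x` is `&(n+1)` and `d'` is `&(n+2)`. -/
def comp {n : ℕ} (φ : LBA.Formula (Fin (n + 1))) : LBA.Sentence :=
  let d : LBA.Term (Empty ⊕ Fin (n + 1)) := top Empty n
  let x : LBA.Term (Empty ⊕ Fin (n + 3)) := lift (top Empty (n + 1))
  let d' : LBA.Term (Empty ⊕ Fin (n + 3)) := top Empty (n + 2)
  let φ' : LBA.BoundedFormula Empty (n + 3) :=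
    BoundedFormula.relabel (n := n + 3) (k := 0)
      (Fin.cases (Sum.inr (Fin.last (n + 2))) (fun i : Fin n => Sum.inr (Fin.castAdd 3 i))) φ
  BoundedFormula.alls
    (isPow d ⟹
      bexLt d
        (ballLt (lift d)
          (isPow d' ⟹ ((digitEq x d' 1 ⊓ φ') ⊔ (digitEq x d' 0 ⊓ ∼φ')))))

/-- The axioms of `T_k`: universal closures of the formulas below, with `x = &0`, `y = &1`,
`z = &2` (and `d = &0` where the variable ranges over powers). -/
inductive IsAxiom (k : ℕ) : LBA.Sentence → Prop
  -- (Add): commutative cancellative monoid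
  | add_assoc : IsAxiom k (BoundedFormula.alls (n := 3)
      (add (add (&0) (&1)) (&2) =' add (&0) (add (&1) (&2))))
  | add_comm : IsAxiom k (BoundedFormula.alls (n := 2) (add (&0) (&1) =' add (&1) (&0)))
  | add_zero : IsAxiom k (BoundedFormula.alls (n := 1) (add (&0) zero =' (&0)))
  | add_cancel : IsAxiom k (BoundedFormula.alls (n := 3)
      ((add (&0) (&2) =' add (&1) (&2)) ⟹ ((&0) =' (&1))))
  -- (Add): `≤` is a linear order compatible with `+`
  | le_refl : IsAxiom k (BoundedFormula.alls (n := 1) (le (&0) (&0)))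
  | le_antisymm : IsAxiom k (BoundedFormula.alls (n := 2)
      ((le (&0) (&1) ⊓ le (&1) (&0)) ⟹ ((&0) =' (&1))))
  | le_trans : IsAxiom k (BoundedFormula.alls (n := 3)
      ((le (&0) (&1) ⊓ le (&1) (&2)) ⟹ le (&0) (&2)))
  | le_total : IsAxiom k (BoundedFormula.alls (n := 2) (le (&0) (&1) ⊔ le (&1) (&0)))
  | add_le_add : IsAxiom k (BoundedFormula.alls (n := 3)
      (le (&0) (&1) ⟹ le (add (&0) (&2)) (add (&1) (&2))))
  -- (Add): the order is discrete, `S(x) = x + 1` being the immediate successor of `x`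
  | succ_eq : IsAxiom k (BoundedFormula.alls (n := 1) (succ (&0) =' add (&0) (numeral 1)))
  | lt_iff_succ_le : IsAxiom k (BoundedFormula.alls (n := 2)
      (lt (&0) (&1) ⇔ le (succ (&0)) (&1)))
  -- (Ord0) `x ≥ 0`
  | ord0 : IsAxiom k (BoundedFormula.alls (n := 1) (le zero (&0)))
  -- (Ord1) `x ≤ y ↔ ∃ z ≤ y (z + x = y)`
  | ord1 : IsAxiom k (BoundedFormula.alls (n := 2)
      (le (&0) (&1) ⇔ bexLe (&1) (add (&2) (&0) =' (&1))))
  -- (Mod) `⋁_{a = 0}^{k - 1} x ≡_k a`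
  | mod : IsAxiom k (BoundedFormula.alls (n := 1)
      (disj (List.range k) fun a => modEq k (&0) (numeral a)))
  -- (V0) `V_k(0) = 0`, `V_k(1) = 1`
  | v0_zero : IsAxiom k (BoundedFormula.alls (n := 0) (V zero =' zero))
  | v0_one : IsAxiom k (BoundedFormula.alls (n := 0) (V (numeral 1) =' numeral 1))
  -- (V1) `V_k(kx) = k V_k(x)`, `P_k(d) → ⋀_{a = 1}^{k - 1} V_k(ad) = d`
  | v1_mul : IsAxiom k (BoundedFormula.alls (n := 1) (V (mul k (&0)) =' mul k (V (&0))))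
  | v1_pow : IsAxiom k (BoundedFormula.alls (n := 1)
      (isPow (&0) ⟹ conj (List.range' 1 (k - 1)) fun a => V (mul a (&0)) =' (&0)))
  -- (V2) `x > 0 ∧ y > 0 ∧ V_k(x) < V_k(y) → V_k(x + y) = V_k(x)`
  | v2 : IsAxiom k (BoundedFormula.alls (n := 2)
      ((lt zero (&0) ⊓ lt zero (&1) ⊓ lt (V (&0)) (V (&1))) ⟹
        (V (add (&0) (&1)) =' V (&0))))
  -- (V3) `x > 0 → ∃ y ≤ x ⋁_{a = 1}^{k - 1} (x = y + a V_k(x) ∧ (V_k(y) > V_k(x) ∨ y = 0))`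
  | v3 : IsAxiom k (BoundedFormula.alls (n := 1)
      (lt zero (&0) ⟹ bexLe (&0)
        (disj (List.range' 1 (k - 1)) fun a =>
          ((&0) =' add (&1) (mul a (V (&0)))) ⊓ (lt (V (&0)) (V (&1)) ⊔ ((&1) =' zero)))))
  -- (V4) `x > 0 → ∃ d ≤ x (P_k(d) ∧ d ≤ x ∧ x < kd)`
  | v4 : IsAxiom k (BoundedFormula.alls (n := 1)
      (lt zero (&0) ⟹ bexLe (&0)
        (isPow (&1) ⊓ (le (&1) (&0) ⊓ lt (&0) (mul k (&1))))))
  -- (V5) `V_k(V_k(x)) = V_k(x)`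
  | v5 : IsAxiom k (BoundedFormula.alls (n := 1) (V (V (&0)) =' V (&0)))
  -- (Comp), for every `Δ₀` formula `φ(d, y)`
  | comp {n : ℕ} (φ : LBA.Formula (Fin (n + 1))) (hφ : IsDelta0 φ) : IsAxiom k (comp φ)

/-- The theory `T_k`. -/
def T (k : ℕ) : LBA.Theory := {φ | IsAxiom k φ}

/-- `U` axiomatizes `B`: the sentences that follow from `U` in first-order logic (are true in all
models of `U`) are exactly the members of `B`. -/
def Axiomatizes (U B : LBA.Theory) : Prop :=
  ∀ φ : LBA.Sentence, (U ⊨ᵇ φ) ↔ φ ∈ B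

end BuchiArithmetic

/-!
Formulas are translated into finite automata that work in all models of `T_k` at once. A tuple `x`
of elements of a model `M` is read as a word over `(Fin k)ⁿ`, its `k`-ary digits, whose positions
are the powers of `k` in `M`; there may be nonstandard ones. A relation is `Automatic` if a single
finite automaton recognizes it in every model. The run of the automaton is not coded by elements of
`M`: it is any `Δ₀`-definable function `st x d` that gives the state after the digits of `x` below
the power `d`, and that follows the transition table when the tuple `x < d` is replaced by `x + a d`
and `d` by `k d` (`IsRun`).

The graphs of `+` and `V_k` are automatic, because the state (the carry, or the comparison of the
valuation with the second argument) has a direct bounded definition; the other symbols are definable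
from these two. Automatic relations are closed under Boolean operations, and under projection by the
subset construction (`IsRun.proj`, `Automatic.exists`): the set of the states `st (x, y) d` with
`y < d` is again a run. The witness `y` may have more digits than `x`, even nonstandardly many more,
so acceptance has to allow for a further block of zeros in `x`. That the sets of states reached
after such a block are reached after a standard number of steps follows by `Δ₀` induction along the
powers of `k` (`isPow_induction`). This is where comprehension is used: the element `x` coding a
`Δ₀` set of powers has the least of them as its valuation (`exists_least_isPow`).

Hence a sentence is decided by whether the initial state of its automaton is accepting, which does
not depend on the model (`realize_iff_realize`). As the standard structure is a model of `T_k`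
(`std_realize`), the consequences of `T_k` are exactly the sentences true in it. The axioms of `T_k`
are themselves `Π₁` sentences (`IsAxiom.isPi1`).
-/

namespace BuchiArithmetic

open FirstOrder FirstOrder.Language FirstOrder.Language.Structure

/-! ### Bounded formulas and relabelling -/

section Delta0

variable {α β : Type} {n m : ℕ}

theorem relabel_lift (g : α → β ⊕ Fin m) (t : LBA.Term (α ⊕ Fin n)) :
    (lift t).relabel (BoundedFormula.relabelAux g (n + 1)) =
      lift (t.relabel (BoundedFormula.relabelAux g n)) := by
  unfold lift
  rw [Term.relabel_relabel, Term.relabel_relabel]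
  congr 1
  funext x
  rcases x with a | i
  · rcases h : g a with b | j
    · simp [BoundedFormula.relabelAux, h]
    · simp only [BoundedFormula.relabelAux, h, Function.comp, Sum.map_inl,
        Equiv.sumAssoc_apply_inl_inr, Sum.map_inr, id, finSumFinEquiv_apply_left]
      rfl
  · simp [BoundedFormula.relabelAux]

theorem relabel_le (g : α → β ⊕ Fin m) (s t : LBA.Term (α ⊕ Fin n)) :
    (le s t).relabel g =
      le (s.relabel (BoundedFormula.relabelAux g n))
        (t.relabel (BoundedFormula.relabelAux g n)) := by
  simp only [le, BoundedFormula.relabel, BoundedFormula.mapTermRel, id]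
  congr 1
  funext i
  fin_cases i <;> rfl

theorem relabel_top (g : α → β ⊕ Fin m) :
    (top α n).relabel (BoundedFormula.relabelAux g (n + 1)) = top β (m + n) := by
  simp [top, BoundedFormula.relabelAux, Term.relabel]

theorem relabel_inf (g : α → β ⊕ Fin m) (φ ψ : LBA.BoundedFormula α n) :
    (φ ⊓ ψ).relabel g = φ.relabel g ⊓ ψ.relabel g := by
  change (φ.imp ψ.not).not.relabel g = ((φ.relabel g).imp (ψ.relabel g).not).not
  rw [BoundedFormula.relabel_not, BoundedFormula.relabel_imp, BoundedFormula.relabel_not]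

theorem IsDelta0.relabel (g : α → β ⊕ Fin m) {φ : LBA.BoundedFormula α n} (h : IsDelta0 φ) :
    IsDelta0 (φ.relabel g) := by
  induction h with
  | falsum => exact .falsum
  | equal s t => exact .equal _ _
  | rel R ts => exact .rel _ _
  | imp _ _ h₁ h₂ => exact .imp h₁ h₂
  | ballLe t _ ih =>
    rw [BuchiArithmetic.ballLe, BoundedFormula.relabel_all, BoundedFormula.relabel_imp, relabel_le,
      relabel_lift, relabel_top]
    exact .ballLe _ ih
  | bexLe t _ ih =>
    rw [BuchiArithmetic.bexLe, BoundedFormula.relabel_ex, relabel_inf, relabel_le, relabel_lift,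
      relabel_top]
    exact .bexLe _ ih

variable {φ ψ : LBA.BoundedFormula α n}

theorem IsDelta0.not (h : IsDelta0 φ) : IsDelta0 (∼φ) := h.imp .falsum

theorem IsDelta0.inf (h : IsDelta0 φ) (h' : IsDelta0 ψ) : IsDelta0 (φ ⊓ ψ) := (h.imp h'.not).not

theorem IsDelta0.sup (h : IsDelta0 φ) (h' : IsDelta0 ψ) : IsDelta0 (φ ⊔ ψ) := h.not.imp h'

theorem IsDelta0.iff (h : IsDelta0 φ) (h' : IsDelta0 ψ) : IsDelta0 (φ ⇔ ψ) :=
  (h.imp h').inf (h'.imp h)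

theorem isDelta0_bot : IsDelta0 (⊥ : LBA.BoundedFormula α n) := .falsum

theorem isDelta0_top : IsDelta0 (⊤ : LBA.BoundedFormula α n) := isDelta0_bot.not

theorem isDelta0_eq (s t : LBA.Term (α ⊕ Fin n)) : IsDelta0 (s =' t) := .equal s t

theorem isDelta0_le (s t : LBA.Term (α ⊕ Fin n)) : IsDelta0 (le s t) := .rel _ _

theorem isDelta0_lt (s t : LBA.Term (α ⊕ Fin n)) : IsDelta0 (lt s t) :=
  (isDelta0_le _ _).inf (isDelta0_eq _ _).not

theorem IsDelta0.ballLt (t : LBA.Term (α ⊕ Fin n)) {φ : LBA.BoundedFormula α (n + 1)}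
    (h : IsDelta0 φ) : IsDelta0 (ballLt t φ) :=
  .ballLe _ ((isDelta0_lt _ _).imp h)

theorem IsDelta0.bexLt (t : LBA.Term (α ⊕ Fin n)) {φ : LBA.BoundedFormula α (n + 1)}
    (h : IsDelta0 φ) : IsDelta0 (bexLt t φ) :=
  .bexLe _ ((isDelta0_lt _ _).inf h)

theorem IsDelta0.disj (l : List ℕ) {f : ℕ → LBA.BoundedFormula α n} (h : ∀ a, IsDelta0 (f a)) :
    IsDelta0 (disj l f) := by
  induction l with
  | nil => exact isDelta0_bot
  | cons a l ih => exact (h a).sup ih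

theorem IsDelta0.conj (l : List ℕ) {f : ℕ → LBA.BoundedFormula α n} (h : ∀ a, IsDelta0 (f a)) :
    IsDelta0 (conj l f) := by
  induction l with
  | nil => exact isDelta0_top
  | cons a l ih => exact (h a).inf ih

theorem isDelta0_isPow (d : LBA.Term (α ⊕ Fin n)) : IsDelta0 (isPow d) :=
  (isDelta0_lt _ _).inf (isDelta0_eq _ _)

theorem isDelta0_modEq (k : ℕ) (x y : LBA.Term (α ⊕ Fin n)) : IsDelta0 (modEq k x y) :=
  .bexLe _ ((isDelta0_eq _ _).sup (isDelta0_eq _ _))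

theorem isDelta0_digitEq (x d : LBA.Term (α ⊕ Fin n)) (a : ℕ) : IsDelta0 (digitEq x d a) :=
  (isDelta0_isPow _).inf (.bexLt _ (.bexLe _ ((isDelta0_eq _ _).inf
    ((isDelta0_eq _ _).sup (isDelta0_lt _ _)))))

end Delta0

/-- Every axiom of `T_k` is already a `Π₁` sentence. -/
theorem IsAxiom.isPi1 {k : ℕ} {φ : LBA.Sentence} (h : IsAxiom k φ) : IsPi1 φ := by
  cases h with
  | comp φ hφ =>
    exact ⟨_, _, (isDelta0_isPow _).imp (.bexLt _ (.ballLt _ ((isDelta0_isPow _).imp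
      (((isDelta0_digitEq _ _ _).inf (hφ.relabel _)).sup
        ((isDelta0_digitEq _ _ _).inf (hφ.relabel _).not))))), rfl⟩
  | mod => exact ⟨_, _, .disj _ fun _ => isDelta0_modEq _ _ _, rfl⟩
  | v1_pow => exact ⟨_, _, (isDelta0_isPow _).imp (.conj _ fun _ => isDelta0_eq _ _), rfl⟩
  | v3 =>
    exact ⟨_, _, (isDelta0_lt _ _).imp (.bexLe _ (.disj _ fun _ =>
      (isDelta0_eq _ _).inf ((isDelta0_lt _ _).sup (isDelta0_eq _ _)))), rfl⟩
  | v4 =>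
    exact ⟨_, _, (isDelta0_lt _ _).imp (.bexLe _ ((isDelta0_isPow _).inf
      ((isDelta0_le _ _).inf (isDelta0_lt _ _)))), rfl⟩
  | v2 =>
    exact ⟨_, _, (((isDelta0_lt _ _).inf (isDelta0_lt _ _)).inf (isDelta0_lt _ _)).imp
      (isDelta0_eq _ _), rfl⟩
  | ord1 => exact ⟨_, _, (isDelta0_le _ _).iff (.bexLe _ (isDelta0_eq _ _)), rfl⟩
  | lt_iff_succ_le => exact ⟨_, _, (isDelta0_lt _ _).iff (isDelta0_le _ _), rfl⟩
  | add_cancel => exact ⟨_, _, (isDelta0_eq _ _).imp (isDelta0_eq _ _), rfl⟩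
  | le_antisymm =>
    exact ⟨_, _, ((isDelta0_le _ _).inf (isDelta0_le _ _)).imp (isDelta0_eq _ _), rfl⟩
  | le_trans => exact ⟨_, _, ((isDelta0_le _ _).inf (isDelta0_le _ _)).imp (isDelta0_le _ _), rfl⟩
  | le_total => exact ⟨_, _, (isDelta0_le _ _).sup (isDelta0_le _ _), rfl⟩
  | add_le_add => exact ⟨_, _, (isDelta0_le _ _).imp (isDelta0_le _ _), rfl⟩
  | le_refl => exact ⟨_, _, isDelta0_le _ _, rfl⟩
  | ord0 => exact ⟨_, _, isDelta0_le _ _, rfl⟩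
  | _ => exact ⟨_, _, isDelta0_eq _ _, rfl⟩

/-! ### Semantics of the abbreviations -/

/-- A structure for the language of Büchi arithmetic, with its operations and its relation exposed
as Lean functions. Nothing is assumed about them. -/
class BuchiStr (M : Type) extends LBA.Structure M, Zero M, Add M, LE M where
  /-- the interpretation of the symbol `S` -/
  sc : M → M
  /-- the interpretation of the symbol `V_k` -/
  val : M → M
  funMap_zero : ∀ v : Fin 0 → M, funMap (Func.zero : LBA.Functions 0) v = 0
  funMap_succ : ∀ v : Fin 1 → M, funMap (Func.succ : LBA.Functions 1) v = sc (v 0)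
  funMap_add : ∀ v : Fin 2 → M, funMap (Func.add : LBA.Functions 2) v = v 0 + v 1
  funMap_V : ∀ v : Fin 1 → M, funMap (Func.V : LBA.Functions 1) v = val (v 0)
  relMap_le : ∀ v : Fin 2 → M, RelMap (Rel.le : LBA.Relations 2) v ↔ v 0 ≤ v 1

/-- Any structure for the language, with its operations read off from the symbols. -/
@[reducible] def BuchiStr.ofStructure (M : Type) [LBA.Structure M] : BuchiStr M where
  zero := funMap (L := LBA) (n := 0) Func.zero ![]
  sc x := funMap (L := LBA) (n := 1) Func.succ ![x]
  add x y := funMap (L := LBA) (n := 2) Func.add ![x, y]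
  val x := funMap (L := LBA) (n := 1) Func.V ![x]
  le x y := RelMap (L := LBA) (n := 2) Rel.le ![x, y]
  funMap_zero _ := congrArg (funMap _) (Subsingleton.elim _ _)
  funMap_succ v := congrArg (funMap (L := LBA) (n := 1) Func.succ) (FinVec.etaExpand_eq v).symm
  funMap_add v := congrArg (funMap (L := LBA) (n := 2) Func.add) (FinVec.etaExpand_eq v).symm
  funMap_V v := congrArg (funMap (L := LBA) (n := 1) Func.V) (FinVec.etaExpand_eq v).symm
  relMap_le v := iff_of_eq
    (congrArg (RelMap (L := LBA) (n := 2) Rel.le) (FinVec.etaExpand_eq v).symm)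

section Realize

variable {M : Type} [BuchiStr M]

/-- The value `x + (x + (… (x + 0)))` of the term `n x`. -/
def nmul (n : ℕ) (x : M) : M := Nat.rec 0 (fun _ y => x + y) n

@[simp] theorem nmul_zero (x : M) : nmul 0 x = 0 := rfl
@[simp] theorem nmul_succ (n : ℕ) (x : M) : nmul (n + 1) x = x + nmul n x := rfl

/-- `P_k(d)` in a structure. -/
def IsPow (d : M) : Prop := ((0 : M) ≤ d ∧ 0 ≠ d) ∧ BuchiStr.val d = d

/-- `(x)_d = a` in a structure. -/
def DigitEq (x d : M) (a : ℕ) : Prop :=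
  IsPow d ∧ ∃ y, y ≤ d ∧ (y ≤ d ∧ y ≠ d) ∧ ∃ z, z ≤ x ∧ x = y + nmul a d + z ∧
    (z = 0 ∨ (d ≤ BuchiStr.val z ∧ d ≠ BuchiStr.val z))

variable {β : Type} (w : β → M)

@[simp] theorem realize_zero : (zero : LBA.Term β).realize w = 0 := BuchiStr.funMap_zero _

@[simp] theorem realize_succ (t : LBA.Term β) :
    (succ t).realize w = BuchiStr.sc (t.realize w) := BuchiStr.funMap_succ _

@[simp] theorem realize_add (s t : LBA.Term β) :
    (add s t).realize w = s.realize w + t.realize w := BuchiStr.funMap_add _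

@[simp] theorem realize_V (t : LBA.Term β) :
    (V t).realize w = BuchiStr.val (t.realize w) := BuchiStr.funMap_V _

@[simp] theorem realize_mul (n : ℕ) (t : LBA.Term β) :
    (mul n t).realize w = nmul n (t.realize w) := by
  induction n with
  | zero => simp [mul]
  | succ n ih => simp [mul, ih]

variable {α : Type} {n : ℕ} (v : α → M) (xs : Fin n → M)

@[simp] theorem realize_lift (t : LBA.Term (α ⊕ Fin n)) (a : M) :
    (lift t).realize (Sum.elim v (Fin.snoc xs a)) = t.realize (Sum.elim v xs) := by
  rw [lift, Term.realize_relabel]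
  congr 1
  funext i
  rcases i with i | i <;> simp

@[simp] theorem realize_top (a : M) :
    (top α n).realize (Sum.elim v (Fin.snoc xs a)) = a := by
  simp [top]

@[simp] theorem realize_le (s t : LBA.Term (α ⊕ Fin n)) :
    (le s t).Realize v xs ↔ s.realize (Sum.elim v xs) ≤ t.realize (Sum.elim v xs) :=
  BuchiStr.relMap_le _

@[simp] theorem realize_lt (s t : LBA.Term (α ⊕ Fin n)) :
    (lt s t).Realize v xs ↔ s.realize (Sum.elim v xs) ≤ t.realize (Sum.elim v xs) ∧
      s.realize (Sum.elim v xs) ≠ t.realize (Sum.elim v xs) := by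
  simp [lt]

@[simp] theorem realize_bexLe (t : LBA.Term (α ⊕ Fin n)) (φ : LBA.BoundedFormula α (n + 1)) :
    (bexLe t φ).Realize v xs ↔
      ∃ a, a ≤ t.realize (Sum.elim v xs) ∧ φ.Realize v (Fin.snoc xs a) := by
  simp [bexLe]

@[simp] theorem realize_bexLt (t : LBA.Term (α ⊕ Fin n)) (φ : LBA.BoundedFormula α (n + 1)) :
    (bexLt t φ).Realize v xs ↔
      ∃ a, a ≤ t.realize (Sum.elim v xs) ∧
        (a ≤ t.realize (Sum.elim v xs) ∧ a ≠ t.realize (Sum.elim v xs)) ∧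
          φ.Realize v (Fin.snoc xs a) := by
  simp [bexLt]

@[simp] theorem realize_ballLt (t : LBA.Term (α ⊕ Fin n)) (φ : LBA.BoundedFormula α (n + 1)) :
    (ballLt t φ).Realize v xs ↔
      ∀ a, a ≤ t.realize (Sum.elim v xs) →
        (a ≤ t.realize (Sum.elim v xs) ∧ a ≠ t.realize (Sum.elim v xs)) →
          φ.Realize v (Fin.snoc xs a) := by
  simp [ballLt, ballLe]

@[simp] theorem realize_disj (l : List ℕ) (f : ℕ → LBA.BoundedFormula α n) :
    (disj l f).Realize v xs ↔ ∃ a ∈ l, (f a).Realize v xs := by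
  simp [disj, BoundedFormula.realize_foldr_sup]

@[simp] theorem realize_conj (l : List ℕ) (f : ℕ → LBA.BoundedFormula α n) :
    (conj l f).Realize v xs ↔ ∀ a ∈ l, (f a).Realize v xs := by
  simp [conj, BoundedFormula.realize_foldr_inf]

@[simp] theorem realize_isPow (d : LBA.Term (α ⊕ Fin n)) :
    (isPow d).Realize v xs ↔ IsPow (d.realize (Sum.elim v xs)) := by
  simp [isPow, IsPow]

@[simp] theorem realize_digitEq (x d : LBA.Term (α ⊕ Fin n)) (a : ℕ) :
    (digitEq x d a).Realize v xs ↔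
      DigitEq (x.realize (Sum.elim v xs)) (d.realize (Sum.elim v xs)) a := by
  simp [digitEq, DigitEq]

theorem realize_modEq (k : ℕ) (x y : LBA.Term (α ⊕ Fin n)) :
    (modEq k x y).Realize v xs ↔ ∃ z, z ≤ x.realize (Sum.elim v xs) + y.realize (Sum.elim v xs) ∧
      (x.realize (Sum.elim v xs) = y.realize (Sum.elim v xs) + nmul k z ∨
        y.realize (Sum.elim v xs) = x.realize (Sum.elim v xs) + nmul k z) := by
  simp [modEq]

/-- The meaning of the comprehension axiom for `φ` in a structure. -/
theorem realize_comp {n : ℕ} (φ : LBA.Formula (Fin (n + 1))) :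
    (M ⊨ comp φ) ↔ ∀ (p : Fin n → M) (d : M), IsPow d →
      ∃ x, (x ≤ d ∧ x ≠ d) ∧ ∀ e, (e ≤ d ∧ e ≠ d) → IsPow e →
        (DigitEq x e 1 ∧ φ.Realize (Fin.cons e p : Fin (n + 1) → M)) ∨
          (DigitEq x e 0 ∧ ¬ φ.Realize (Fin.cons e p : Fin (n + 1) → M)) := by
  have key : ∀ (p : Fin n → M) (d x e : M),
      (BoundedFormula.relabel (n := n + 3) (k := 0)
        (Fin.cases (Sum.inr (Fin.last (n + 2))) (fun i : Fin n => Sum.inr (Fin.castAdd 3 i)) :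
          Fin (n + 1) → Empty ⊕ Fin (n + 3)) φ).Realize default
        (Fin.snoc (Fin.snoc (Fin.snoc p d : Fin (n + 1) → M) x : Fin (n + 2) → M) e :
          Fin (n + 3) → M) ↔
        φ.Realize (Fin.cons e p : Fin (n + 1) → M) := by
    intro p d x e
    rw [BoundedFormula.realize_relabel, Formula.Realize]
    refine iff_of_eq (congrArg₂ _ ?_ (Subsingleton.elim _ _))
    funext i
    refine Fin.cases ?_ (fun i => ?_) i
    · simp only [Function.comp, Fin.cases_zero, Sum.elim_inr, Fin.cons_zero]
      exact Fin.snoc_last (α := fun _ => M) _ _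
    · simp only [Function.comp, Fin.cases_succ, Sum.elim_inr, Fin.cons_succ]
      change (Fin.snoc (Fin.snoc (Fin.snoc p d : Fin (n + 1) → M) x : Fin (n + 2) → M) e :
          Fin (n + 3) → M) i.castSucc.castSucc.castSucc = _
      simp only [Fin.snoc_castSucc]
  -- the bounded quantifier `x < d` unfolds to `x ≤ d ∧ x < d`; the repetition is removed
  have inner : ∀ (p : Fin n → M) (d : M), (IsPow d →
      ∃ x, x ≤ d ∧ (x ≤ d ∧ x ≠ d) ∧ ∀ e, e ≤ d → (e ≤ d ∧ e ≠ d) → IsPow e →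
        (DigitEq x e 1 ∧ φ.Realize (Fin.cons e p : Fin (n + 1) → M)) ∨
          (DigitEq x e 0 ∧ ¬ φ.Realize (Fin.cons e p : Fin (n + 1) → M))) ↔ (IsPow d →
      ∃ x, (x ≤ d ∧ x ≠ d) ∧ ∀ e, (e ≤ d ∧ e ≠ d) → IsPow e →
        (DigitEq x e 1 ∧ φ.Realize (Fin.cons e p : Fin (n + 1) → M)) ∨
          (DigitEq x e 0 ∧ ¬ φ.Realize (Fin.cons e p : Fin (n + 1) → M))) := by
    intro p d
    constructor
    · intro h hd
      obtain ⟨x, hx, hx', h⟩ := h hd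
      exact ⟨x, hx', fun e he => h e he.1 he⟩
    · intro h hd
      obtain ⟨x, hx', h⟩ := h hd
      exact ⟨x, hx'.1, hx', fun e _ he => h e he⟩
  simp only [← inner]
  rw [comp, Sentence.Realize, BoundedFormula.realize_alls]
  rw [← (Fin.snocEquiv fun _ : Fin (n + 1) => M).forall_congr_right, Prod.forall, forall_comm]
  refine forall_congr' fun p => forall_congr' fun d => ?_
  change BoundedFormula.Realize _ _ (Fin.snoc p d : Fin (n + 1) → M) ↔ _
  simp only [BoundedFormula.realize_imp, realize_isPow, realize_bexLt,
    realize_ballLt, realize_lift, realize_top, BoundedFormula.realize_sup,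
    BoundedFormula.realize_inf, BoundedFormula.realize_not, realize_digitEq, key]

end Realize

open BuchiStr (sc val)

/-! ### Models of the theory as ordered monoids -/

/-- A structure for the language that is the nonnegative part of a discretely ordered group,
presented as an ordered cancellative commutative monoid. The element `sc 0` plays the role of `1`. -/
class OrdModel (M : Type) extends BuchiStr M, AddCommMonoid M, LinearOrder M,
    IsOrderedCancelAddMonoid M where
  sc_eq : ∀ x : M, sc x = x + sc 0
  lt_iff_sc_le : ∀ x y : M, x < y ↔ sc x ≤ y
  nonneg : ∀ x : M, 0 ≤ x
  exists_add : ∀ x y : M, x ≤ y → ∃ z, z + x = y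

/-- The properties of `V_k` and the comprehension scheme, in the form in which they are used. -/
class BuchiModel (k : ℕ) (M : Type) [OrdModel M] : Prop where
  val_zero : val (0 : M) = 0
  val_one : val (sc 0 : M) = sc 0
  val_nsmul : ∀ x : M, val (k • x) = k • val x
  val_nsmul_pow : ∀ (d : M) (a : ℕ), IsPow d → 1 ≤ a → a < k → val (a • d) = d
  val_add : ∀ x y : M, 0 < x → 0 < y → val x < val y → val (x + y) = val x
  exists_last : ∀ x : M, 0 < x → ∃ (y : M) (a : ℕ), 1 ≤ a ∧ x = y + a • val x ∧
    (val x < val y ∨ y = 0)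
  exists_pow : ∀ x : M, 0 < x → ∃ d, IsPow d ∧ d ≤ x ∧ x < k • d
  val_val : ∀ x : M, val (val x) = val x
  comprehension : ∀ (n : ℕ) (φ : LBA.Formula (Fin (n + 1))), IsDelta0 φ →
    ∀ (p : Fin n → M) (d : M), IsPow d →
      ∃ x, x < d ∧ ∀ e, e < d → IsPow e →
        (DigitEq x e 1 ∧ φ.Realize (Fin.cons e p : Fin (n + 1) → M)) ∨
          (DigitEq x e 0 ∧ ¬ φ.Realize (Fin.cons e p : Fin (n + 1) → M))

theorem nmul_eq_nsmul {M : Type} [OrdModel M] (n : ℕ) (x : M) : nmul n x = n • x := by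
  induction n with
  | zero => simp
  | succ n ih => rw [nmul_succ, ih, succ_nsmul']

/-- Every model of `T_k` is a `BuchiModel`, with the same interpretation of the language. -/
theorem exists_buchiModel {k : ℕ} {M : Type} (S : LBA.Structure M)
    (h : ∀ φ : LBA.Sentence, IsAxiom k φ → M ⊨ φ) :
    ∃ B : OrdModel M, BuchiModel k M ∧ B.toStructure = S := by
  let B : BuchiStr M := BuchiStr.ofStructure M
  have h' : ∀ φ : LBA.Sentence, IsAxiom k φ → M ⊨ φ := h
  have h_assoc := h' _ .add_assoc
  have h_comm := h' _ .add_comm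
  have h_zero := h' _ .add_zero
  have h_cancel := h' _ .add_cancel
  have h_refl := h' _ .le_refl
  have h_anti := h' _ .le_antisymm
  have h_trans := h' _ .le_trans
  have h_total := h' _ .le_total
  have h_addle := h' _ .add_le_add
  have h_succ := h' _ .succ_eq
  have h_lt := h' _ .lt_iff_succ_le
  have h_ord0 := h' _ .ord0
  have h_ord1 := h' _ .ord1
  have h_v0 := h' _ .v0_zero
  have h_v0' := h' _ .v0_one
  have h_v1 := h' _ .v1_mul
  have h_v1' := h' _ .v1_pow
  have h_v2 := h' _ .v2
  have h_v3 := h' _ .v3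
  have h_v4 := h' _ .v4
  have h_v5 := h' _ .v5
  simp only [Sentence.Realize, BoundedFormula.realize_alls, ← FinVec.forall_iff, FinVec.Forall] at *
  simp [numeral] at *
  have lt_iff : ∀ x y : M, (x ≤ y ∧ ¬ x = y) ↔ (x ≤ y ∧ ¬ y ≤ x) := fun x y =>
    ⟨fun h => ⟨h.1, fun h₂ => h.2 (h_anti _ _ h.1 h₂)⟩,
      fun h => ⟨h.1, fun h₂ => h.2 (h₂ ▸ h_refl _)⟩⟩
  -- the default `<` of the order means `x ≤ y ∧ ¬ y ≤ x`, while the axioms speak of `x ≤ y ∧ x ≠ y`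
  let C : OrdModel M :=
    { B with
      add_assoc := h_assoc
      add_comm := h_comm
      zero_add := fun x => (h_comm _ _).trans (h_zero x)
      add_zero := h_zero
      nsmul := nsmulRec
      le_refl := h_refl
      le_antisymm := h_anti
      le_trans := h_trans
      le_total := h_total
      toDecidableLE := Classical.decRel _
      add_le_add_left := fun a b hab c => h_addle a b c hab
      le_of_add_le_add_left := fun a b c habc => by
        rcases h_total b c with h₁ | h₁
        · exact h₁
        · have h₂ := h_addle _ _ a h₁
          rw [h_comm c, h_comm b] at h₂
          have h₃ := h_anti _ _ habc h₂
          rw [h_comm a, h_comm a] at h₃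
          exact h_cancel _ _ _ h₃ ▸ h_refl _
      sc_eq := h_succ
      lt_iff_sc_le := fun x y => (lt_iff x y).symm.trans (h_lt x y)
      nonneg := h_ord0
      exists_add := fun x y hxy =>
        let ⟨z, _, hz⟩ := (h_ord1 x y).1 hxy
        ⟨z, hz⟩ }
  have lt_iff' : ∀ x y : M, x < y ↔ (x ≤ y ∧ ¬ x = y) := fun x y => (lt_iff x y).symm
  have nm : ∀ (n : ℕ) (x : M), nmul n x = n • x := nmul_eq_nsmul
  refine ⟨C, ?_, rfl⟩
  constructor
  · exact h_v0
  · exact h_v0'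
  · intro x
    rw [← nm, ← nm]
    exact h_v1 x
  · intro d a hd h₁ h₂
    rw [← nm]
    exact h_v1' d hd a h₁ (by omega)
  · intro x y hx hy hxy
    rw [lt_iff'] at hx hy hxy
    exact h_v2 x y hx.1 hx.2 hy.1 hy.2 hxy.1 hxy.2
  · intro x hx
    rw [lt_iff'] at hx
    obtain ⟨y, _, a, ha, hxy, h₁⟩ := h_v3 x hx.1 hx.2
    refine ⟨y, a, ha.1, ?_, ?_⟩
    · rw [← nm]
      exact hxy
    · rw [lt_iff']
      exact h₁
  · intro x hx
    rw [lt_iff'] at hx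
    obtain ⟨d, _, hd, hdx, hxd⟩ := h_v4 x hx.1 hx.2
    refine ⟨d, hd, hdx, ?_⟩
    rw [lt_iff', ← nm]
    exact hxd
  · exact h_v5
  · intro n φ hφ p d hd
    obtain ⟨x, hx, h₁⟩ := (realize_comp φ).1 (h' _ (.comp φ hφ)) p d hd
    exact ⟨x, (lt_iff' _ _).2 hx, fun e he => h₁ e ((lt_iff' _ _).1 he)⟩

/-! ### Powers of `k` and valuations in models -/

section Ordered

variable {M : Type} [OrdModel M]

theorem isPow_iff {d : M} : IsPow d ↔ 0 < d ∧ val d = d := by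
  rw [IsPow, lt_iff_le_and_ne]

theorem IsPow.pos {d : M} (h : IsPow d) : 0 < d := (isPow_iff.1 h).1

theorem IsPow.val_eq {d : M} (h : IsPow d) : val d = d := h.2

theorem pos_of_ne_zero {x : M} (h : x ≠ 0) : 0 < x := lt_of_le_of_ne (OrdModel.nonneg x) h.symm

theorem sc_zero_pos : (0 : M) < sc 0 := (OrdModel.lt_iff_sc_le 0 (sc 0)).2 le_rfl

theorem lt_sc_zero_iff {x : M} : x < sc 0 ↔ x = 0 := by
  refine ⟨fun h => ?_, fun h => by rw [h]; exact sc_zero_pos⟩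
  by_contra hx
  exact absurd ((OrdModel.lt_iff_sc_le _ _).1 (pos_of_ne_zero hx)) (not_le.2 h)

theorem le_add_left' (x y : M) : x ≤ y + x := le_add_of_nonneg_left (OrdModel.nonneg y)

theorem le_add_right' (x y : M) : x ≤ x + y := le_add_of_nonneg_right (OrdModel.nonneg y)

theorem eq_zero_of_add_eq_zero {x y : M} (h : x + y = 0) : x = 0 ∧ y = 0 := by
  have hx : x ≤ 0 := h ▸ le_add_right' x y
  have hy : y ≤ 0 := h ▸ le_add_left' y x
  exact ⟨le_antisymm hx (OrdModel.nonneg _), le_antisymm hy (OrdModel.nonneg _)⟩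

theorem nsmul_le_nsmul_of_le {d : M} {m n : ℕ} (h : m ≤ n) : m • d ≤ n • d := by
  obtain ⟨c, rfl⟩ := Nat.exists_eq_add_of_le' h
  rw [add_nsmul]
  exact le_add_left' _ _

theorem add_nsmul_lt {d u : M} {m n : ℕ} (hu : u < d) (h : m < n) : u + m • d < n • d :=
  calc u + m • d < d + m • d := add_lt_add_left hu _
    _ = (m + 1) • d := (succ_nsmul' d m).symm
    _ ≤ n • d := nsmul_le_nsmul_of_le h

/-- Uniqueness of division with remainder by `d`, for standard quotients. -/
theorem add_nsmul_inj {d u v : M} {m n : ℕ} (hu : u < d) (hv : v < d)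
    (h : u + m • d = v + n • d) : m = n ∧ u = v := by
  have key : ∀ {u v : M} {m n : ℕ}, u < d → u + m • d = v + n • d → ¬ m < n := fun hu h hmn =>
    absurd h (ne_of_lt ((add_nsmul_lt hu hmn).trans_le (le_add_left' _ _)))
  obtain rfl : m = n := le_antisymm (not_lt.1 (key hv h.symm)) (not_lt.1 (key hu h))
  exact ⟨rfl, add_right_cancel h⟩

/-- Division with remainder by `d`, for standard quotients. -/
theorem exists_add_nsmul_of_lt {d x : M} {n : ℕ} (h : x < n • d) :
    ∃ (u : M) (a : ℕ), u < d ∧ a < n ∧ x = u + a • d := by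
  induction n with
  | zero =>
    rw [zero_nsmul] at h
    exact absurd h (not_lt.2 (OrdModel.nonneg x))
  | succ n ih =>
    rcases lt_or_ge x (n • d) with hx | hx
    · obtain ⟨u, a, hu, ha, hx⟩ := ih hx
      exact ⟨u, a, hu, by omega, hx⟩
    · obtain ⟨u, rfl⟩ := OrdModel.exists_add _ _ hx
      refine ⟨u, n, ?_, by omega, rfl⟩
      rw [succ_nsmul'] at h
      exact lt_of_add_lt_add_right h

theorem lt_nsmul_self {k : ℕ} (hk : 2 ≤ k) {x : M} (h : 0 < x) : x < k • x :=
  calc x = 1 • x := (one_nsmul x).symm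
    _ < 2 • x := by rw [one_nsmul, two_nsmul]; exact lt_add_of_pos_left x h
    _ ≤ k • x := nsmul_le_nsmul_of_le hk

end Ordered

section Valuation

variable {k : ℕ} {M : Type} [OrdModel M]

theorem val_pos (k : ℕ) [BuchiModel k M] {x : M} (hx : 0 < x) : 0 < val x := by
  by_contra h
  have h₀ : val x = 0 := by
    by_contra h₁
    exact h (pos_of_ne_zero h₁)
  obtain ⟨y, a, _, hxy, h₁⟩ := BuchiModel.exists_last k x hx
  rw [h₀, nsmul_zero, add_zero] at hxy
  subst hxy
  rcases h₁ with h₁ | h₁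
  · exact lt_irrefl _ h₁
  · exact hx.ne' h₁

theorem val_le (k : ℕ) [BuchiModel k M] (x : M) : val x ≤ x := by
  rcases eq_or_ne x 0 with rfl | hx
  · exact (BuchiModel.val_zero k).le
  · obtain ⟨y, a, ha, hxy, -⟩ := BuchiModel.exists_last k x (pos_of_ne_zero hx)
    calc val x = 1 • val x := (one_nsmul _).symm
      _ ≤ a • val x := nsmul_le_nsmul_of_le ha
      _ ≤ y + a • val x := le_add_left' _ _
      _ = x := hxy.symm

theorem isPow_val (k : ℕ) [BuchiModel k M] {x : M} (hx : 0 < x) : IsPow (val x) :=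
  isPow_iff.2 ⟨val_pos k hx, BuchiModel.val_val k x⟩

theorem isPow_one (k : ℕ) [BuchiModel k M] : IsPow (sc 0 : M) :=
  isPow_iff.2 ⟨sc_zero_pos, BuchiModel.val_one k⟩

theorem isPow_nsmul [BuchiModel k M] (hk : 2 ≤ k) {d : M} (hd : IsPow d) : IsPow (k • d) :=
  isPow_iff.2 ⟨hd.pos.trans (lt_nsmul_self hk hd.pos), by
    rw [BuchiModel.val_nsmul, hd.val_eq]⟩

/-- No power of `k` lies strictly between `e` and `k e`. -/
theorem eq_of_isPow_of_lt [BuchiModel k M] {d e : M} (hd : IsPow d) (he : IsPow e) (h₁ : e ≤ d)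
    (h₂ : d < k • e) : d = e := by
  obtain ⟨u, a, hu, ha, hx⟩ := exists_add_nsmul_of_lt h₂
  have ha₀ : 1 ≤ a := by
    rcases Nat.eq_zero_or_pos a with rfl | h
    · rw [zero_nsmul, add_zero] at hx
      exact absurd (hx ▸ hu) (not_lt.2 h₁)
    · exact h
  have hval := BuchiModel.val_nsmul_pow e a he ha₀ ha
  rcases eq_or_ne u 0 with rfl | hu₀
  · rw [zero_add] at hx
    rw [← hx, hd.val_eq] at hval
    exact hval
  · have hu₁ : val u < e := (val_le k u).trans_lt hu
    have h₃ := BuchiModel.val_add (k := k) u (a • e) (pos_of_ne_zero hu₀)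
      (he.pos.trans_le (by simpa using nsmul_le_nsmul_of_le (d := e) ha₀)) (hval.symm ▸ hu₁)
    rw [← hx, hd.val_eq] at h₃
    exact absurd (h₃ ▸ hu₁) (not_lt.2 h₁)

/-- Every power of `k` other than `1` is `k` times another one. -/
theorem exists_isPow_nsmul_eq [BuchiModel k M] {d : M} (hd : IsPow d) (h : sc 0 < d) :
    ∃ e, IsPow e ∧ e < d ∧ d = k • e := by
  -- the largest power `e ≤ d - 1` satisfies `e < d ≤ k e`
  obtain ⟨x, rfl⟩ := OrdModel.exists_add _ _ h.le
  have hx : 0 < x := pos_of_ne_zero fun h₀ => by simp [h₀] at h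
  obtain ⟨e, he, hex, hxe⟩ := BuchiModel.exists_pow (k := k) x hx
  have h₁ : x + sc 0 ≤ k • e := by
    rw [← OrdModel.sc_eq]
    exact (OrdModel.lt_iff_sc_le _ _).1 hxe
  have h₂ : e < x + sc 0 := hex.trans_lt (lt_add_of_pos_right x sc_zero_pos)
  refine ⟨e, he, h₂, ?_⟩
  rcases h₁.lt_or_eq with h₃ | h₃
  · exact absurd (eq_of_isPow_of_lt hd he h₂.le h₃) h₂.ne'
  · exact h₃

theorem exists_isPow_gt [BuchiModel k M] (hk : 2 ≤ k) (x : M) : ∃ d, IsPow d ∧ x < d := by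
  rcases eq_or_ne x 0 with rfl | hx
  · exact ⟨sc 0, isPow_one k, sc_zero_pos⟩
  · obtain ⟨d, hd, -, h⟩ := BuchiModel.exists_pow (k := k) x (pos_of_ne_zero hx)
    exact ⟨k • d, isPow_nsmul hk hd, h⟩

theorem exists_isPow_forall_lt [BuchiModel k M] (hk : 2 ≤ k) {n : ℕ} (x : Fin n → M) (y : M) :
    ∃ d, IsPow d ∧ y ≤ d ∧ ∀ i, x i < d := by
  obtain ⟨m, hm⟩ := (Set.finite_range (Fin.cons y x : Fin (n + 1) → M)).bddAbove
  obtain ⟨d, hd, hmd⟩ := exists_isPow_gt hk m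
  exact ⟨d, hd, (hm ⟨0, rfl⟩).trans hmd.le, fun i => (hm ⟨i.succ, rfl⟩).trans_lt hmd⟩

/-- The digit of `x` at the place `V_k(x)` is not `0`. -/
theorem not_digitEq_zero_val (k : ℕ) [BuchiModel k M] {x : M} : ¬ DigitEq x (val x) 0 := by
  rintro ⟨-, y, -, hy, z, -, hxz, h⟩
  have hy : y < val x := lt_of_le_of_ne hy.1 hy.2
  rw [nmul_zero, add_zero] at hxz
  rcases h with rfl | h
  · rw [add_zero] at hxz
    rw [← hxz] at hy
    exact absurd hy (not_lt.2 (val_le k x))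
  · have h : val x < val z := lt_of_le_of_ne h.1 h.2
    rcases eq_or_ne y 0 with rfl | hy₀
    · rw [zero_add] at hxz
      rw [hxz] at h
      exact lt_irrefl _ h
    · have hyz : val y < val z := (val_le k y).trans_lt (hy.trans h)
      have hz : 0 < z := pos_of_ne_zero fun hz => by
        rw [hz, BuchiModel.val_zero k] at h
        exact absurd h (not_lt.2 (OrdModel.nonneg _))
      have h₁ := BuchiModel.val_add (k := k) y z (pos_of_ne_zero hy₀) hz hyz
      rw [← hxz] at h₁
      have h₂ := (val_le k y).trans_lt hy
      rw [h₁] at h₂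
      exact lt_irrefl _ h₂

/-- A place where `x` has the digit `1` is at least `V_k(x)`. -/
theorem val_le_of_digitEq_one (k : ℕ) [BuchiModel k M] {x d : M} (h : DigitEq x d 1) :
    0 < x ∧ val x ≤ d := by
  obtain ⟨hd, y, -, hy, z, -, hxz, h⟩ := h
  have hy : y < d := lt_of_le_of_ne hy.1 hy.2
  rw [nmul_succ, nmul_zero, add_zero] at hxz
  have hw : 0 < y + d := add_pos_of_nonneg_of_pos (OrdModel.nonneg y) hd.pos
  have hx : 0 < x := hxz ▸ add_pos_of_pos_of_nonneg hw (OrdModel.nonneg z)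
  refine ⟨hx, ?_⟩
  have hwd : val (y + d) ≤ d := by
    rcases eq_or_ne y 0 with rfl | hy₀
    · rw [zero_add, hd.val_eq]
    · have hyd : val y < d := (val_le k y).trans_lt hy
      rw [BuchiModel.val_add (k := k) y d (pos_of_ne_zero hy₀) hd.pos (hd.val_eq.symm ▸ hyd)]
      exact hyd.le
  rcases h with rfl | h
  · rw [add_zero] at hxz
    exact hxz ▸ hwd
  · have h : d < val z := lt_of_le_of_ne h.1 h.2
    have hz : 0 < z := pos_of_ne_zero fun hz => by
      rw [hz, BuchiModel.val_zero k] at h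
      exact absurd h (not_lt.2 (OrdModel.nonneg _))
    rw [hxz, BuchiModel.val_add (k := k) (y + d) z hw hz (hwd.trans_lt h)]
    exact hwd

end Valuation

/-! ### Definability by bounded formulas and induction along the powers -/

section Definability

variable {M : Type} [OrdModel M] {n m : ℕ}

/-- Definability of an `n`-ary relation on `M` by a `Δ₀` formula without parameters. -/
def Delta0Def (A : (Fin n → M) → Prop) : Prop :=
  ∃ φ : LBA.Formula (Fin n), IsDelta0 φ ∧ ∀ v, φ.Realize v ↔ A v

theorem Delta0Def.congr {A B : (Fin n → M) → Prop} (h : Delta0Def A) (hAB : ∀ v, A v ↔ B v) :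
    Delta0Def B := (funext fun v => propext (hAB v)) ▸ h

theorem Delta0Def.not {A : (Fin n → M) → Prop} (h : Delta0Def A) :
    Delta0Def fun v => ¬ A v := by
  obtain ⟨φ, hφ, h⟩ := h
  exact ⟨∼φ, hφ.not, fun v => not_congr (h v)⟩

theorem Delta0Def.and {A B : (Fin n → M) → Prop} (h : Delta0Def A) (h' : Delta0Def B) :
    Delta0Def fun v => A v ∧ B v := by
  obtain ⟨φ, hφ, h⟩ := h
  obtain ⟨ψ, hψ, h'⟩ := h'
  exact ⟨φ ⊓ ψ, hφ.inf hψ, fun v => BoundedFormula.realize_inf.trans (and_congr (h v) (h' v))⟩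

theorem Delta0Def.or {A B : (Fin n → M) → Prop} (h : Delta0Def A) (h' : Delta0Def B) :
    Delta0Def fun v => A v ∨ B v :=
  (h.not.and h'.not).not.congr fun v => by tauto

theorem Delta0Def.imp {A B : (Fin n → M) → Prop} (h : Delta0Def A) (h' : Delta0Def B) :
    Delta0Def fun v => A v → B v :=
  (h.not.or h').congr fun v => by tauto

theorem Delta0Def.iff {A B : (Fin n → M) → Prop} (h : Delta0Def A) (h' : Delta0Def B) :
    Delta0Def fun v => A v ↔ B v :=
  ((h.imp h').and (h'.imp h)).congr fun v => by tauto

theorem delta0Def_const (p : Prop) : Delta0Def fun _ : Fin n → M => p := by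
  have h : Delta0Def fun _ : Fin n → M => False := ⟨⊥, isDelta0_bot, fun _ => Iff.rfl⟩
  by_cases hp : p
  · exact h.not.congr fun v => by simp [hp]
  · exact h.congr fun v => by simp [hp]

theorem Delta0Def.exists_finite {ι : Type} [Finite ι] {A : ι → (Fin n → M) → Prop}
    (h : ∀ i, Delta0Def (A i)) : Delta0Def fun v => ∃ i, A i v := by
  have key : ∀ s : Set ι, s.Finite → Delta0Def fun v => ∃ i ∈ s, A i v := fun s hs => by
    refine Set.Finite.induction_on s hs ?_ ?_
    · exact (delta0Def_const False).congr fun v => by simp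
    · intro i s _ _ ih
      exact ((h i).or ih).congr fun v => by simp
  exact (key Set.univ Set.finite_univ).congr fun v => by simp

theorem Delta0Def.forall_finite {ι : Type} [Finite ι] {A : ι → (Fin n → M) → Prop}
    (h : ∀ i, Delta0Def (A i)) : Delta0Def fun v => ∀ i, A i v :=
  (Delta0Def.exists_finite fun i => (h i).not).not.congr fun v => by simp

theorem Delta0Def.comap {A : (Fin n → M) → Prop} (h : Delta0Def A) (f : Fin n → Fin m) :
    Delta0Def fun v : Fin m → M => A (v ∘ f) := by
  obtain ⟨φ, hφ, h⟩ := h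
  exact ⟨φ.relabel f, hφ.relabel _, fun _ => Formula.realize_relabel.trans (h _)⟩

theorem delta0Def_eq (s t : LBA.Term (Fin n)) :
    Delta0Def fun v : Fin n → M => s.realize v = t.realize v :=
  ⟨s.equal t, .equal _ _, fun _ => Formula.realize_equal⟩

theorem delta0Def_le (i j : Fin n) : Delta0Def fun v : Fin n → M => v i ≤ v j :=
  ⟨le (Term.var (Sum.inl i)) (Term.var (Sum.inl j)), isDelta0_le _ _,
    fun _ => realize_le _ _ _ _⟩

/-- A bounded quantifier, the bound being the variable `0`. -/
theorem Delta0Def.exists_lt {A : (Fin (n + 2) → M) → Prop} (h : Delta0Def A) :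
    Delta0Def fun v : Fin (n + 1) → M => ∃ y, y < v 0 ∧ A (Fin.snoc v y) := by
  obtain ⟨φ, hφ, h⟩ := h
  let g : Fin (n + 2) → Fin (n + 1) ⊕ Fin 1 := Fin.lastCases (Sum.inr 0) Sum.inl
  refine ⟨bexLt (Term.var (Sum.inl 0)) (BoundedFormula.relabel g φ),
    .bexLt _ (hφ.relabel g), fun v => ?_⟩
  refine (realize_bexLt _ _ _ _).trans (exists_congr fun y => ?_)
  have h₁ : (BoundedFormula.relabel g φ).Realize v (Fin.snoc default y : Fin 1 → M) ↔
      A (Fin.snoc v y) := by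
    rw [← h, BoundedFormula.realize_relabel, Formula.Realize]
    refine iff_of_eq (congrArg₂ _ ?_ (Subsingleton.elim _ _))
    funext i
    refine Fin.lastCases ?_ (fun i => ?_) i
    · simp [g]
      rfl
    · simp [g]
  rw [lt_iff_le_and_ne]
  exact ⟨fun h => ⟨h.2.1, h₁.1 h.2.2⟩, fun h => ⟨h.1.1, h.1, h₁.2 h.2⟩⟩

variable {k : ℕ} [BuchiModel k M]

/-- A `Δ₀` property of some power `d` has a least power satisfying it: by comprehension, some `x`
has the digit `1` exactly at the places with this property, and `V_k(x)` is the least of them. -/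
theorem exists_least_isPow (hk : 2 ≤ k) {A : (Fin (n + 1) → M) → Prop} (hA : Delta0Def A)
    (p : Fin n → M) {d : M} (hd : IsPow d) (h : A (Fin.cons d p)) :
    ∃ e, IsPow e ∧ A (Fin.cons e p) ∧ ∀ c, IsPow c → c < e → ¬ A (Fin.cons c p) := by
  obtain ⟨φ, hφ, hφA⟩ := hA
  obtain ⟨x, hx, hdig⟩ := BuchiModel.comprehension (k := k) n φ hφ p (k • d) (isPow_nsmul hk hd)
  simp only [hφA] at hdig
  have hle : ∀ c, IsPow c → c < k • d → A (Fin.cons c p) → 0 < x ∧ val x ≤ c :=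
    fun c hc hcd hcA => by
      rcases hdig c hcd hc with h₁ | h₁
      · exact val_le_of_digitEq_one k h₁.1
      · exact absurd hcA h₁.2
  have hx₀ : 0 < x := (hle d hd (lt_nsmul_self hk hd.pos) h).1
  have hxd : val x < k • d := (val_le k x).trans_lt hx
  refine ⟨val x, isPow_val k hx₀, ?_, fun c hc hcx hcA => ?_⟩
  · rcases hdig _ hxd (isPow_val k hx₀) with h₁ | h₁
    · exact h₁.2
    · exact absurd h₁.1 (not_digitEq_zero_val k)
  · exact absurd hcx (not_lt.2 (hle c hc (hcx.trans hxd) hcA).2)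

/-- Induction along the powers of `k` for `Δ₀` properties. -/
theorem isPow_induction (hk : 2 ≤ k) {A : (Fin (n + 1) → M) → Prop} (hA : Delta0Def A)
    (p : Fin n → M) {d₀ : M} (hd₀ : IsPow d₀) (h₀ : A (Fin.cons d₀ p))
    (step : ∀ d, IsPow d → d₀ ≤ d → A (Fin.cons d p) → A (Fin.cons (k • d) p)) :
    ∀ d, IsPow d → d₀ ≤ d → A (Fin.cons d p) := by
  intro d hd hd₀d
  by_contra hAd
  -- the property is `d₀ ≤ d ∧ ¬ A d`, with `d₀` as an additional parameter
  let B : (Fin (n + 1 + 1) → M) → Prop := fun v =>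
    v (Fin.last (n + 1)) ≤ v 0 ∧ ¬ A (v ∘ Fin.castSucc)
  have hB : Delta0Def B := (delta0Def_le _ _).and (hA.comap Fin.castSucc).not
  have hBiff : ∀ c, B (Fin.cons c (Fin.snoc p d₀ : Fin (n + 1) → M)) ↔
      d₀ ≤ c ∧ ¬ A (Fin.cons c p) := fun c => by
    have h₁ : (Fin.cons c (Fin.snoc p d₀ : Fin (n + 1) → M) : Fin (n + 2) → M) ∘ Fin.castSucc =
        (Fin.cons c p : Fin (n + 1) → M) := by
      rw [Fin.cons_snoc_eq_snoc_cons]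
      funext i
      exact Fin.snoc_castSucc (α := fun _ => M) _ _ _
    have h₂ : (Fin.cons c (Fin.snoc p d₀ : Fin (n + 1) → M) : Fin (n + 2) → M)
        (Fin.last (n + 1)) = d₀ := by
      rw [Fin.cons_snoc_eq_snoc_cons]
      exact Fin.snoc_last (α := fun _ => M) _ _
    simp only [B, h₁, h₂, Fin.cons_zero]
  obtain ⟨e, he, hBe, hmin⟩ := exists_least_isPow hk hB _ hd ((hBiff d).2 ⟨hd₀d, hAd⟩)
  rw [hBiff] at hBe
  have hne : d₀ < e := lt_of_le_of_ne hBe.1 fun h => hBe.2 (h ▸ h₀)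
  have h1 : sc 0 < e := lt_of_le_of_lt ((OrdModel.lt_iff_sc_le _ _).1 hd₀.pos) hne
  obtain ⟨c, hc, hce, rfl⟩ := exists_isPow_nsmul_eq (k := k) he h1
  have hd₀c : d₀ ≤ c := by
    by_contra h
    exact absurd (eq_of_isPow_of_lt hd₀ hc (not_le.1 h).le hne) (not_le.1 h).ne'
  have hcA : A (Fin.cons c p) := by
    by_contra h
    exact hmin c hc hce ((hBiff c).2 ⟨hd₀c, h⟩)
  exact hBe.2 (step c hc hd₀c hcA)

end Definability

/-! ### Uniformly automatic relations -/

section Automata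

/-- An `n`-ary relation given simultaneously on all models. -/
def URel (n : ℕ) : Type 1 := ∀ (M : Type) [OrdModel M], (Fin n → M) → Prop

/-- `st x d` is the state which the automaton `A` reaches on the digits of `x` at the places below
`d` (least significant digit first), for a power `d` and a tuple `x` of elements below `d`. The
places range over the possibly nonstandard powers of `k` in `M`, so that this is a run of possibly
nonstandard length; it has to be definable by bounded formulas, where the variable `0` stands
for `d`. -/
structure IsRun {k n : ℕ} {Q : Type} (A : DFA (Fin n → Fin k) Q) {M : Type} [OrdModel M]
    (st : (Fin n → M) → M → Q) : Prop where
  definable : ∀ q, Delta0Def fun v : Fin (n + 1) → M => st (Fin.tail v) (v 0) = q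
  start : st (fun _ => 0) (sc 0) = A.start
  step : ∀ (x : Fin n → M) (d : M) (a : Fin n → Fin k), IsPow d → (∀ i, x i < d) →
    st (fun i => x i + (a i : ℕ) • d) (k • d) = A.step (st x d) a

/-- A relation is automatic if one finite automaton recognizes it in every model. -/
def Automatic (k : ℕ) {n : ℕ} (R : URel n) : Prop :=
  ∃ (Q : Type) (_ : Finite Q) (A : DFA (Fin n → Fin k) Q),
    ∀ (M : Type) [OrdModel M] [BuchiModel k M], ∃ st : (Fin n → M) → M → Q, IsRun A st ∧
      ∀ (x : Fin n → M) (d : M), IsPow d → (∀ i, x i < d) → (st x d ∈ A.accept ↔ R M x)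

variable {k n m : ℕ}

theorem IsRun.definable_mem {Q : Type} [Finite Q] {A : DFA (Fin n → Fin k) Q} {M : Type}
    [OrdModel M] {st : (Fin n → M) → M → Q} (h : IsRun A st) (Z : Set Q) :
    Delta0Def fun v : Fin (n + 1) → M => st (Fin.tail v) (v 0) ∈ Z :=
  (Delta0Def.exists_finite fun q => (h.definable q).and (delta0Def_const (q ∈ Z))).congr
    fun v => by simp

theorem Automatic.congr {R R' : URel n} (h : Automatic k R)
    (hRR' : ∀ (M : Type) [OrdModel M] [BuchiModel k M] (x : Fin n → M), R M x ↔ R' M x) :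
    Automatic k R' := by
  obtain ⟨Q, hQ, A, h⟩ := h
  refine ⟨Q, hQ, A, fun M _ _ => ?_⟩
  obtain ⟨st, hst, hR⟩ := h M
  exact ⟨st, hst, fun x d hd hx => (hR x d hd hx).trans (hRR' M x)⟩

theorem Automatic.not {R : URel n} (h : Automatic k R) :
    Automatic k (n := n) fun M _ x => ¬ R M x := by
  obtain ⟨Q, hQ, A, h⟩ := h
  refine ⟨Q, hQ, ⟨A.step, A.start, A.acceptᶜ⟩, fun M _ _ => ?_⟩
  obtain ⟨st, hst, hR⟩ := h M
  exact ⟨st, ⟨hst.definable, hst.start, hst.step⟩, fun x d hd hx => not_congr (hR x d hd hx)⟩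

theorem Automatic.and {R R' : URel n} (h : Automatic k R) (h' : Automatic k R') :
    Automatic k (n := n) fun M _ x => R M x ∧ R' M x := by
  obtain ⟨Q, hQ, A, h⟩ := h
  obtain ⟨Q', hQ', A', h'⟩ := h'
  refine ⟨Q × Q', inferInstance, ⟨fun q a => (A.step q.1 a, A'.step q.2 a), (A.start, A'.start),
    A.accept ×ˢ A'.accept⟩, fun M _ _ => ?_⟩
  obtain ⟨st, hst, hR⟩ := h M
  obtain ⟨st', hst', hR'⟩ := h' M
  refine ⟨fun x d => (st x d, st' x d), ⟨fun q => ?_, ?_, fun x d a hd hx => ?_⟩,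
    fun x d hd hx => and_congr (hR x d hd hx) (hR' x d hd hx)⟩
  · exact ((hst.definable q.1).and (hst'.definable q.2)).congr fun v => by rw [Prod.ext_iff]
  · exact Prod.ext hst.start hst'.start
  · exact Prod.ext (hst.step x d a hd hx) (hst'.step x d a hd hx)

theorem Automatic.imp {R R' : URel n} (h : Automatic k R) (h' : Automatic k R') :
    Automatic k (n := n) fun M _ x => R M x → R' M x :=
  (h.and h'.not).not.congr fun M _ _ x => by simp

/-- Substitution of variables for variables. -/
theorem Automatic.comap {R : URel n} (h : Automatic k R) (f : Fin n → Fin m) :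
    Automatic k (n := m) fun M _ x => R M (x ∘ f) := by
  obtain ⟨Q, hQ, A, h⟩ := h
  refine ⟨Q, hQ, ⟨fun q a => A.step q (a ∘ f), A.start, A.accept⟩, fun M _ _ => ?_⟩
  obtain ⟨st, hst, hR⟩ := h M
  refine ⟨fun x d => st (x ∘ f) d, ⟨fun q => ?_, hst.start, fun x d a hd hx => ?_⟩,
    fun x d hd hx => hR _ d hd fun i => hx _⟩
  · exact ((hst.definable q).comap (Fin.cons 0 (Fin.succ ∘ f) : Fin (n + 1) → Fin (m + 1))).congr
      fun v => Iff.rfl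
  · exact hst.step (x ∘ f) d (a ∘ f) hd fun i => hx _

/-- The subset construction for the existential quantifier over the last variable: the digits of
the last component are guessed, and a set of states is accepted if it leads to an accepting state
after finitely many steps in which all other digits are `0`. -/
def projDFA {Q : Type} (A : DFA (Fin (n + 1) → Fin k) Q) (z : Fin k) :
    DFA (Fin n → Fin k) (Set Q) where
  step S a := {q | ∃ p ∈ S, ∃ b : Fin k, A.step p (Fin.snoc a b) = q}
  start := {A.start}
  accept := {S | ∃ j : ℕ,
    ((fun S => {q | ∃ p ∈ S, ∃ b : Fin k, A.step p (Fin.snoc (fun _ => z) b) = q})^[j] S ∩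
      A.accept).Nonempty}

theorem snoc_lt_iff {M : Type} [OrdModel M] {x : Fin n → M} {y d : M} :
    (∀ i, (Fin.snoc x y : Fin (n + 1) → M) i < d) ↔ (∀ i, x i < d) ∧ y < d := by
  rw [Fin.forall_fin_succ']
  simp

theorem IsRun.proj {Q : Type} [Finite Q] {A : DFA (Fin (n + 1) → Fin k) Q} {M : Type}
    [OrdModel M] [BuchiModel k M] {st : (Fin (n + 1) → M) → M → Q} (h : IsRun A st) (z : Fin k) :
    IsRun (projDFA A z) fun (x : Fin n → M) d => {q | ∃ y, y < d ∧ st (Fin.snoc x y) d = q} where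
  definable S := by
    have h₁ : ∀ q, Delta0Def fun v : Fin (n + 1) → M =>
        (∃ y, y < v 0 ∧ st (Fin.snoc (Fin.tail v) y) (v 0) = q) ↔ q ∈ S := fun q => by
      refine ((h.definable q).exists_lt.congr fun v => ?_).iff (delta0Def_const (q ∈ S))
      refine exists_congr fun y => and_congr_right fun _ => ?_
      have h₂ : Fin.tail (Fin.snoc v y : Fin (n + 2) → M) = Fin.snoc (Fin.tail v) y := by
        conv_lhs => rw [← Fin.cons_self_tail v, ← Fin.cons_snoc_eq_snoc_cons]
        exact Fin.tail_cons _ _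
      have h₃ : (Fin.snoc v y : Fin (n + 2) → M) 0 = v 0 :=
        Fin.snoc_castSucc (α := fun _ => M) y v 0
      rw [h₂, h₃]
    exact (Delta0Def.forall_finite h₁).congr fun v => Set.ext_iff.symm
  start := by
    have h₁ : (Fin.snoc (fun _ => 0) 0 : Fin (n + 1) → M) = fun _ => 0 := by
      funext i
      refine Fin.lastCases ?_ (fun i => ?_) i <;> simp
    ext q
    simp only [lt_sc_zero_iff, exists_eq_left, h₁, h.start, projDFA, Set.mem_ofPred_eq,
      Set.mem_singleton_iff, eq_comm]
  step x d a hd hx := by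
    have h₁ : ∀ (u : M) (b : Fin k), u < d →
        st (Fin.snoc (fun i => x i + (a i : ℕ) • d) (u + (b : ℕ) • d)) (k • d) =
          A.step (st (Fin.snoc x u) d) (Fin.snoc a b) := fun u b hu => by
      rw [← h.step _ d _ hd (snoc_lt_iff.2 ⟨hx, hu⟩)]
      congr 1
      funext i
      refine Fin.lastCases ?_ (fun i => ?_) i <;> simp
    ext q
    constructor
    · rintro ⟨y, hy, rfl⟩
      obtain ⟨u, b, hu, hb, rfl⟩ := exists_add_nsmul_of_lt hy
      exact ⟨_, ⟨u, hu, rfl⟩, ⟨b, hb⟩, (h₁ u ⟨b, hb⟩ hu).symm⟩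
    · rintro ⟨_, ⟨u, hu, rfl⟩, b, rfl⟩
      exact ⟨u + (b : ℕ) • d, add_nsmul_lt hu b.2, h₁ u b hu⟩

theorem Automatic.exists (hk : 2 ≤ k) {R : URel (n + 1)} (h : Automatic k R) :
    Automatic k (n := n) fun M _ x => ∃ y, R M (Fin.snoc x y) := by
  obtain ⟨Q, hQ, A, h⟩ := h
  let z : Fin k := ⟨0, by omega⟩
  refine ⟨Set Q, inferInstance, projDFA A z, fun M _ _ => ?_⟩
  obtain ⟨st, hst, hR⟩ := h M
  have hrun := hst.proj z
  refine ⟨_, hrun, fun x d hd hx => ?_⟩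
  set st' : (Fin n → M) → M → Set Q := fun x d => {q | ∃ y, y < d ∧ st (Fin.snoc x y) d = q}
    with hst'
  set f : Set Q → Set Q :=
    fun S => {q | ∃ p ∈ S, ∃ b : Fin k, A.step p (Fin.snoc (fun _ => z) b) = q} with hf
  have hstep : ∀ e, IsPow e → (∀ i, x i < e) → st' x (k • e) = f (st' x e) := fun e he hxe => by
    have h₁ := hrun.step x e (fun _ => z) he hxe
    simp only [z, zero_nsmul, add_zero] at h₁
    exact h₁
  change (∃ j, (f^[j] (st' x d) ∩ A.accept).Nonempty) ↔ _
  constructor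
  · rintro ⟨j, q, hq, hqA⟩
    have h₁ : ∀ j, ∃ e, IsPow e ∧ (∀ i, x i < e) ∧ st' x e = f^[j] (st' x d) := fun j => by
      induction j with
      | zero => exact ⟨d, hd, hx, rfl⟩
      | succ j ih =>
        obtain ⟨e, he, hxe, hj⟩ := ih
        refine ⟨k • e, isPow_nsmul hk he, fun i => (hxe i).trans (lt_nsmul_self hk he.pos), ?_⟩
        rw [hstep e he hxe, hj, Function.iterate_succ_apply']
    obtain ⟨e, he, hxe, hj⟩ := h₁ j
    rw [← hj] at hq
    obtain ⟨y, hy, rfl⟩ := hq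
    exact ⟨y, (hR _ e he (snoc_lt_iff.2 ⟨hxe, hy⟩)).1 hqA⟩
  · rintro ⟨y, hy⟩
    obtain ⟨e, he, hde, hye⟩ := exists_isPow_forall_lt (k := k) hk (fun _ : Fin 1 => y) d
    -- the number of steps from `d` to `e` may be nonstandard, but the set of states reached after
    -- a standard number of steps is closed under further steps
    have h₁ := isPow_induction (k := k) hk (hrun.definable_mem {S | ∃ j, S = f^[j] (st' x d)}) x hd
      ⟨0, rfl⟩ (fun c hc hdc hj => by
        obtain ⟨j, hj⟩ := hj
        refine ⟨j + 1, ?_⟩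
        rw [Function.iterate_succ_apply', ← hj]
        exact hstep c hc fun i => (hx i).trans_le hdc) e he hde
    obtain ⟨j, hj⟩ := h₁
    refine ⟨j, st (Fin.snoc x y) e, ?_, ?_⟩
    · rw [← hj]
      exact ⟨y, hye 0, rfl⟩
    · exact (hR _ e he (snoc_lt_iff.2 ⟨fun i => (hx i).trans_le hde, hye 0⟩)).2 hy

theorem Automatic.forall (hk : 2 ≤ k) {R : URel (n + 1)} (h : Automatic k R) :
    Automatic k (n := n) fun M _ x => ∀ y, R M (Fin.snoc x y) :=
  (h.not.exists hk).not.congr fun M _ _ x => by simp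

/-- An automatic relation without variables has the same truth value in all models. -/
theorem Automatic.iff_of_zero {R : URel 0} (h : Automatic k R) (M N : Type) [OrdModel M]
    [BuchiModel k M] [OrdModel N] [BuchiModel k N] (x : Fin 0 → M) (y : Fin 0 → N) :
    R M x ↔ R N y := by
  obtain ⟨Q, hQ, A, h⟩ := h
  have key : ∀ (M : Type) [OrdModel M] [BuchiModel k M] (x : Fin 0 → M),
      R M x ↔ A.start ∈ A.accept := fun M _ _ x => by
    obtain ⟨st, hst, hR⟩ := h M
    rw [← hR x (sc 0) (isPow_one k) finZeroElim, Subsingleton.elim x fun _ => 0, hst.start]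
  rw [key M, key N]

end Automata

/-! ### The relations definable in the language are automatic -/

section Formulas

variable {k n : ℕ}

theorem automatic_false (k n : ℕ) : Automatic k (n := n) fun _ _ _ => False :=
  ⟨Unit, inferInstance, ⟨fun _ _ => (), (), ∅⟩, fun _ _ _ => ⟨fun _ _ => (),
    ⟨fun _ => (delta0Def_const True).congr fun _ => by simp, rfl, fun _ _ _ _ _ => rfl⟩,
    fun _ _ _ _ => Iff.rfl⟩⟩

/-- Addition is automatic, the state being the set of the possible carries: those `c` with
`x 0 + x 1 = x 2 + c d`. -/
theorem automatic_add (k : ℕ) : Automatic k (n := 3) fun _ _ x => x 0 + x 1 = x 2 := by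
  refine ⟨Set (Fin 2), inferInstance,
    ⟨fun S a => {c | ∃ e ∈ S, (e : ℕ) + a 0 + a 1 = a 2 + c * k}, {0}, {S | 0 ∈ S}⟩,
    fun M _ _ => ⟨fun x d => {c | x 0 + x 1 = x 2 + (c : ℕ) • d}, ⟨fun S => ?_, ?_, ?_⟩, ?_⟩⟩
  · have h : ∀ c : Fin 2, Delta0Def fun v : Fin 4 → M =>
        v 1 + v 2 = v 3 + (c : ℕ) • v 0 ↔ c ∈ S := fun c =>
      ((delta0Def_eq (add (Term.var 1) (Term.var 2))
        (add (Term.var 3) (mul c (Term.var 0)))).congr fun v => by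
          simp [nmul_eq_nsmul]).iff (delta0Def_const _)
    exact (Delta0Def.forall_finite h).congr fun v => Set.ext_iff.symm
  · ext c
    have h := (sc_zero_pos (M := M)).ne'
    fin_cases c <;> simp [h.symm]
  · intro x d a hd hx
    ext c
    have h₁ : x 0 + (a 0 : ℕ) • d + (x 1 + (a 1 : ℕ) • d) =
        x 0 + x 1 + ((a 0 : ℕ) + a 1) • d := by
      rw [add_nsmul]
      exact add_add_add_comm _ _ _ _
    have h₂ : x 2 + (a 2 : ℕ) • d + (c : ℕ) • (k • d) = x 2 + ((a 2 : ℕ) + c * k) • d := by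
      rw [add_nsmul, mul_nsmul', add_assoc]
    change _ = _ ↔ ∃ e : Fin 2, x 0 + x 1 = x 2 + (e : ℕ) • d ∧ _
    rw [h₁, h₂]
    constructor
    · intro h
      have h₃ : x 0 + x 1 < 2 • d := by
        rw [two_nsmul]
        exact add_lt_add (hx 0) (hx 1)
      obtain ⟨u, e, hu, he, hx'⟩ := exists_add_nsmul_of_lt h₃
      rw [hx', add_assoc, ← add_nsmul] at h
      obtain ⟨h₄, rfl⟩ := add_nsmul_inj hu (hx 2) h
      exact ⟨⟨e, he⟩, hx', by simpa [add_assoc] using h₄⟩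
    · rintro ⟨e, he, hk⟩
      rw [he, ← hk, add_assoc, add_assoc, ← add_nsmul]
  · intro x d _ _
    change x 0 + x 1 = x 2 + ((0 : Fin 2) : ℕ) • d ↔ _
    simp

theorem nsmul_eq_zero_iff' {M : Type} [OrdModel M] {d : M} (hd : 0 < d) {a : ℕ} :
    a • d = 0 ↔ a = 0 := by
  refine ⟨fun h => ?_, fun h => by rw [h, zero_nsmul]⟩
  by_contra ha
  have h₁ := nsmul_le_nsmul_of_le (d := d) (Nat.one_le_iff_ne_zero.2 ha)
  rw [one_nsmul, h] at h₁
  exact absurd hd (not_lt.2 h₁)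

theorem val_add_nsmul [NeZero k] {M : Type} [OrdModel M] [BuchiModel k M] {x d : M} (hd : IsPow d)
    (hx : x < d) (hx₀ : x ≠ 0) (a : Fin k) : val (x + (a : ℕ) • d) = val x := by
  rcases Nat.eq_zero_or_pos a with ha | ha
  · rw [ha, zero_nsmul, add_zero]
  · refine BuchiModel.val_add (k := k) x _ (pos_of_ne_zero hx₀) ?_ ?_
    · exact pos_of_ne_zero fun h => ha.ne' ((nsmul_eq_zero_iff' hd.pos).1 h)
    · rw [BuchiModel.val_nsmul_pow d a hd ha a.2]
      exact (val_le k x).trans_lt hx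

/-- The graph of `V_k` is automatic. The state records whether both arguments are still `0`, and
whether the first is not `0` and its valuation is the second. -/
theorem automatic_val (k : ℕ) : Automatic k (n := 2) fun _ _ x => val (x 0) = x 1 := by
  refine ⟨Prop × Prop, inferInstance,
    ⟨fun q a => (q.1 ∧ (a 0 : ℕ) = 0 ∧ (a 1 : ℕ) = 0,
      (q.1 ∧ (a 0 : ℕ) ≠ 0 ∧ (a 1 : ℕ) = 1) ∨ (q.2 ∧ (a 1 : ℕ) = 0)), (True, False),
      {q | q.1 ∨ q.2}⟩,
    fun M _ _ => ⟨fun x _ => (x 0 = 0 ∧ x 1 = 0, x 0 ≠ 0 ∧ val (x 0) = x 1),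
      ⟨fun q => ?_, ?_, ?_⟩, ?_⟩⟩
  · have h : ∀ i : Fin 3, Delta0Def fun v : Fin 3 → M => v i = 0 := fun i =>
      (delta0Def_eq (Term.var i) zero).congr fun v => by simp
    have h' : Delta0Def fun v : Fin 3 → M => val (v 1) = v 2 :=
      (delta0Def_eq (V (Term.var 1)) (Term.var 2)).congr fun v => by simp
    refine ((((h 1).and (h 2)).iff (delta0Def_const q.1)).and
      (((h 1).not.and h').iff (delta0Def_const q.2))).congr fun v => ?_
    rw [Prod.ext_iff, ← iff_eq_eq, ← iff_eq_eq]
    rfl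
  · simp
  · intro x d a hd hx
    have h₀ : ∀ i, x i + (a i : ℕ) • d = 0 ↔ x i = 0 ∧ (a i : ℕ) = 0 := fun i => by
      rw [← nsmul_eq_zero_iff' hd.pos]
      exact ⟨eq_zero_of_add_eq_zero, fun h => by rw [h.1, h.2, add_zero]⟩
    refine Prod.ext (propext ?_) (propext ?_)
    · simp only [h₀]
      tauto
    · simp only [ne_eq, h₀]
      rcases eq_or_ne (x 0) 0 with hx₀ | hx₀
      · rcases Nat.eq_zero_or_pos (a 0) with ha | ha
        · simp [hx₀, ha]
        · have h₁ : d = x 1 + (a 1 : ℕ) • d ↔ x 1 = 0 ∧ (a 1 : ℕ) = 1 := by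
            constructor
            · intro h
              obtain ⟨h₁, h₂⟩ := add_nsmul_inj (m := 1) (n := a 1) (u := 0) hd.pos (hx 1)
                (by rw [one_nsmul, zero_add]; exact h)
              exact ⟨h₂.symm, h₁.symm⟩
            · rintro ⟨h₁, h₂⟩
              rw [h₁, h₂, one_nsmul, zero_add]
          rw [hx₀, zero_add, BuchiModel.val_nsmul_pow d (a 0) hd ha (a 0).2, h₁]
          simp only [ha.ne', true_and]
          tauto
      · have : NeZero k := ⟨fun h => (Fin.cast h (a 0)).elim0⟩
        have h₁ : val (x 0) = x 1 + (a 1 : ℕ) • d ↔ val (x 0) = x 1 ∧ (a 1 : ℕ) = 0 := by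
          constructor
          · intro h
            obtain ⟨h₁, h₂⟩ := add_nsmul_inj (m := 0) (n := a 1)
              ((val_le k (x 0)).trans_lt (hx 0)) (hx 1)
              (by rw [zero_nsmul, add_zero]; exact h)
            exact ⟨h₂, h₁.symm⟩
          · rintro ⟨h₁, h₂⟩
            rw [h₁, h₂, zero_nsmul, add_zero]
        rw [val_add_nsmul hd (hx 0) hx₀, h₁]
        tauto
  · intro x d _ _
    change (x 0 = 0 ∧ x 1 = 0) ∨ (x 0 ≠ 0 ∧ val (x 0) = x 1) ↔ _
    rcases eq_or_ne (x 0) 0 with hx₀ | hx₀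
    · simp [hx₀, BuchiModel.val_zero k, eq_comm]
    · simp [hx₀]

theorem automatic_eq_zero (k : ℕ) : Automatic k (n := 1) fun _ _ x => x 0 = 0 :=
  ((automatic_add k).comap (m := 1) ![0, 0, 0]).congr fun M _ _ x => by simp

theorem automatic_le (hk : 2 ≤ k) : Automatic k (n := 2) fun _ _ x => x 0 ≤ x 1 :=
  (((automatic_add k).comap (m := 3) ![2, 0, 1]).exists hk).congr fun M _ _ x => by
    refine Iff.trans ?_ ⟨fun ⟨z, hz⟩ => hz ▸ le_add_left' (x 0) z, OrdModel.exists_add _ _⟩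
    exact exists_congr fun z => by simp [Fin.snoc]

theorem automatic_eq (hk : 2 ≤ k) : Automatic k (n := 2) fun _ _ x => x 0 = x 1 :=
  ((automatic_le hk).and ((automatic_le hk).comap (m := 2) ![1, 0])).congr fun M _ _ x => by
    simp [le_antisymm_iff]

/-- The number `1` is the least element other than `0`. -/
theorem automatic_eq_one (hk : 2 ≤ k) : Automatic k (n := 1) fun _ _ x => x 0 = sc 0 :=
  ((automatic_eq_zero k).not.and ((((automatic_le hk).comap (m := 2) ![0, 1]).not.imp
    ((automatic_eq_zero k).comap (m := 2) ![1])).forall hk)).congr fun M _ _ x => by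
      simp only [Function.comp, Matrix.cons_val_zero, Matrix.cons_val_one]
      simp only [Fin.snoc, not_le]
      simp
      constructor
      · rintro ⟨h₁, h₂⟩
        refine le_antisymm (not_lt.1 fun h => sc_zero_pos.ne' (h₂ _ h)) ?_
        exact (OrdModel.lt_iff_sc_le _ _).1 (pos_of_ne_zero h₁)
      · intro h
        rw [h]
        exact ⟨sc_zero_pos.ne', fun y hy => lt_sc_zero_iff.1 hy⟩

theorem automatic_sc (hk : 2 ≤ k) : Automatic k (n := 2) fun _ _ x => sc (x 0) = x 1 :=
  ((((automatic_eq_one hk).comap (m := 3) ![2]).and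
    ((automatic_add k).comap (m := 3) ![0, 2, 1])).exists hk).congr fun M _ _ x => by
      simp [Fin.snoc, ← OrdModel.sc_eq]

/-- The graph of a term, the last variable being its value, is automatic. -/
theorem automatic_term (hk : 2 ≤ k) (t : LBA.Term (Empty ⊕ Fin n)) :
    Automatic k (n := n + 1) fun _ _ x =>
      t.realize (Sum.elim default (Fin.init x)) = x (Fin.last n) := by
  induction t with
  | var i =>
    rcases i with i | i
    · exact i.elim
    · exact ((automatic_eq hk).comap ![i.castSucc, Fin.last n]).congr fun M _ _ x => by
        simp [Fin.init]
  | func f ts ih =>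
    cases f with
    | zero =>
      refine ((automatic_eq_zero k).comap ![Fin.last n]).congr fun M _ _ x => ?_
      have h : (Term.func Func.zero ts).realize (Sum.elim default (Fin.init x)) = (0 : M) :=
        BuchiStr.funMap_zero _
      simp [h, eq_comm]
    | succ =>
      refine ((((ih 0).comap (Fin.snoc (fun i => i.castSucc.castSucc) (Fin.last (n + 1)))).and
        ((automatic_sc hk).comap ![Fin.last (n + 1), (Fin.last n).castSucc])).exists hk).congr
          fun M _ _ x => ?_
      have h : (Term.func Func.succ ts).realize (Sum.elim default (Fin.init x)) =
          (sc ((ts 0).realize (Sum.elim default (Fin.init x))) : M) := BuchiStr.funMap_succ _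
      rw [h]
      simp [Fin.init_def, Function.comp_def]
    | V =>
      refine ((((ih 0).comap (Fin.snoc (fun i => i.castSucc.castSucc) (Fin.last (n + 1)))).and
        ((automatic_val k).comap ![Fin.last (n + 1), (Fin.last n).castSucc])).exists hk).congr
          fun M _ _ x => ?_
      have h : (Term.func Func.V ts).realize (Sum.elim default (Fin.init x)) =
          (val ((ts 0).realize (Sum.elim default (Fin.init x))) : M) := BuchiStr.funMap_V _
      rw [h]
      simp [Fin.init_def, Function.comp_def]
    | add =>
      refine ((((ih 0).comap (Fin.snoc (fun i => i.castSucc.castSucc.castSucc)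
        (Fin.last (n + 1)).castSucc)).and (((ih 1).comap (Fin.snoc
          (fun i => i.castSucc.castSucc.castSucc) (Fin.last (n + 2)))).and
        ((automatic_add k).comap ![(Fin.last (n + 1)).castSucc, Fin.last (n + 2),
          (Fin.last n).castSucc.castSucc]))).exists hk |>.exists hk).congr fun M _ _ x => ?_
      have h : (Term.func Func.add ts).realize (Sum.elim default (Fin.init x)) =
          ((ts 0).realize (Sum.elim default (Fin.init x)) +
            (ts 1).realize (Sum.elim default (Fin.init x)) : M) := BuchiStr.funMap_add _
      rw [h]
      simp [Fin.init_def, Function.comp_def]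

/-- Every formula defines an automatic relation. -/
theorem automatic_formula (hk : 2 ≤ k) (φ : LBA.BoundedFormula Empty n) :
    Automatic k (n := n) fun _ _ x => φ.Realize default x := by
  induction φ with
  | falsum => exact automatic_false k _
  | equal s t =>
    refine (((automatic_term hk s).and (automatic_term hk t)).exists hk).congr fun M _ _ x => ?_
    change _ ↔ s.realize _ = t.realize _
    simp [eq_comm]
  | @rel n l R ts =>
    cases R
    refine ((((automatic_term hk (ts 0)).comap (Fin.snoc (fun i => i.castSucc.castSucc)
      (Fin.last n).castSucc)).and (((automatic_term hk (ts 1)).comap (Fin.snoc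
        (fun i => i.castSucc.castSucc) (Fin.last (n + 1)))).and ((automatic_le hk).comap
          ![(Fin.last n).castSucc, Fin.last (n + 1)]))).exists hk |>.exists hk).congr
            fun M _ _ x => ?_
    refine Iff.trans ?_ (BuchiStr.relMap_le _).symm
    simp [Fin.init_def, Function.comp_def]
  | imp φ ψ hφ hψ => exact (hφ.imp hψ).congr fun M _ _ x => Iff.rfl
  | all φ hφ => exact (hφ.forall hk).congr fun M _ _ x => Iff.rfl

/-- Any two models satisfy the same sentences. -/
theorem realize_iff_realize (hk : 2 ≤ k) (φ : LBA.Sentence) (M N : Type) [OrdModel M]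
    [BuchiModel k M] [OrdModel N] [BuchiModel k N] : (M ⊨ φ) ↔ (N ⊨ φ) :=
  (automatic_formula hk φ).iff_of_zero M N default default

end Formulas

/-! ### The standard model -/

section Standard

/-- The standard structure with its operations exposed. -/
@[reducible] noncomputable def natStr (k : ℕ) : BuchiStr ℕ where
  toStructure := stdStructure k
  sc := Nat.succ
  val := vVal k
  funMap_zero _ := rfl
  funMap_succ _ := rfl
  funMap_add _ := rfl
  funMap_V _ := rfl
  relMap_le _ := Iff.rfl

variable {k : ℕ}

theorem vVal_pow_mul (hk : 2 ≤ k) (n : ℕ) {q : ℕ} (hq : ¬ k ∣ q) :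
    vVal k (k ^ n * q) = k ^ n := by
  have h₀ : 0 < k ^ n := Nat.pow_pos (by omega)
  have hq₀ : q ≠ 0 := fun h => hq (h ▸ dvd_zero _)
  rw [vVal, if_neg (Nat.mul_ne_zero h₀.ne' hq₀), multiplicity_eq_of_dvd_of_not_dvd (k := n)]
  · exact dvd_mul_right _ _
  · rw [pow_succ]
    exact fun h => hq (Nat.dvd_of_mul_dvd_mul_left h₀ h)

theorem exists_eq_pow_mul (hk : 2 ≤ k) {x : ℕ} (hx : x ≠ 0) : ∃ n q, x = k ^ n * q ∧ ¬ k ∣ q := by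
  have hfin : FiniteMultiplicity k x := Nat.finiteMultiplicity_iff.2 ⟨by omega, by omega⟩
  obtain ⟨q, h₁, h₂⟩ := hfin.exists_eq_pow_mul_and_not_dvd
  exact ⟨_, q, h₁, h₂⟩

theorem pow_le_vVal (hk : 2 ≤ k) {x n : ℕ} (hx : x ≠ 0) (h : k ^ n ∣ x) : k ^ n ≤ vVal k x :=
  (isGreatest_vVal hk (Nat.pos_of_ne_zero hx)).2 ⟨⟨n, rfl⟩, h⟩

theorem vVal_pow (hk : 2 ≤ k) (n : ℕ) : vVal k (k ^ n) = k ^ n := by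
  have h := vVal_pow_mul hk n (q := 1) (by rw [Nat.dvd_one]; omega)
  rwa [mul_one] at h

theorem vVal_mul_self (hk : 2 ≤ k) (x : ℕ) : vVal k (k * x) = k * vVal k x := by
  rcases eq_or_ne x 0 with rfl | hx
  · simp [vVal_zero]
  · obtain ⟨n, q, rfl, hq⟩ := exists_eq_pow_mul hk hx
    rw [← mul_assoc, ← pow_succ', vVal_pow_mul hk _ hq, vVal_pow_mul hk _ hq, pow_succ']

theorem vVal_mul_pow (hk : 2 ≤ k) (n : ℕ) {a : ℕ} (ha : 1 ≤ a) (hak : a < k) :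
    vVal k (a * k ^ n) = k ^ n := by
  rw [mul_comm]
  exact vVal_pow_mul hk n (Nat.not_dvd_of_pos_of_lt ha hak)

theorem vVal_add (hk : 2 ≤ k) {x y : ℕ} (hx : x ≠ 0) (hy : y ≠ 0) (h : vVal k x < vVal k y) :
    vVal k (x + y) = vVal k x := by
  obtain ⟨n, q, rfl, hq⟩ := exists_eq_pow_mul hk hx
  obtain ⟨m, r, rfl, hr⟩ := exists_eq_pow_mul hk hy
  rw [vVal_pow_mul hk n hq, vVal_pow_mul hk m hr] at h
  have hnm : n < m := (Nat.pow_lt_pow_iff_right (by omega)).1 h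
  obtain ⟨c, rfl⟩ := Nat.exists_eq_add_of_lt hnm
  have h₁ : k ^ n * q + k ^ (n + c + 1) * r = k ^ n * (q + k * (k ^ c * r)) := by ring
  rw [h₁, vVal_pow_mul hk n hq, vVal_pow_mul hk n]
  rwa [Nat.dvd_add_left (dvd_mul_right _ _)]

theorem exists_last_digit (hk : 2 ≤ k) {x : ℕ} (hx : x ≠ 0) :
    ∃ y ≤ x, ∃ a, (1 ≤ a ∧ a < k) ∧ x = y + a * vVal k x ∧
      ((vVal k x ≤ vVal k y ∧ vVal k x ≠ vVal k y) ∨ y = 0) := by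
  obtain ⟨n, q, rfl, hq⟩ := exists_eq_pow_mul hk hx
  rw [vVal_pow_mul hk n hq]
  have h₁ : k ^ n * q = k ^ (n + 1) * (q / k) + q % k * k ^ n := by
    conv_lhs => rw [← Nat.div_add_mod q k]
    ring
  refine ⟨k ^ (n + 1) * (q / k), by omega, q % k, ⟨?_, Nat.mod_lt _ (by omega)⟩, h₁, ?_⟩
  · exact Nat.pos_of_ne_zero fun h => hq (Nat.dvd_of_mod_eq_zero h)
  · rcases eq_or_ne (k ^ (n + 1) * (q / k)) 0 with h₂ | h₂
    · exact Or.inr h₂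
    · have h₃ := pow_le_vVal hk h₂ (dvd_mul_right _ _)
      have h₄ : k ^ n < k ^ (n + 1) := Nat.pow_lt_pow_right (by omega) (by omega)
      exact Or.inl ⟨by omega, by omega⟩

theorem vVal_vVal (hk : 2 ≤ k) (x : ℕ) : vVal k (vVal k x) = vVal k x := by
  rcases eq_or_ne x 0 with rfl | hx
  · simp [vVal_zero]
  · obtain ⟨n, q, rfl, hq⟩ := exists_eq_pow_mul hk hx
    rw [vVal_pow_mul hk _ hq, vVal_pow hk]

/-- Digits `0` and `1` can be prescribed arbitrarily at the places below `k ^ m`. -/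
theorem exists_digits (hk : 2 ≤ k) (b : ℕ → ℕ) (hb : ∀ i, b i ≤ 1) (m : ℕ) :
    ∃ x < k ^ m, ∀ i < m, ∃ y w, y < k ^ i ∧ x = y + b i * k ^ i + k ^ (i + 1) * w := by
  induction m with
  | zero => exact ⟨0, by simp, fun i hi => absurd hi (Nat.not_lt_zero i)⟩
  | succ m ih =>
    obtain ⟨x, hx, h⟩ := ih
    refine ⟨x + b m * k ^ m, ?_, fun i hi => ?_⟩
    · calc x + b m * k ^ m < k ^ m + 1 * k ^ m :=
            Nat.add_lt_add_of_lt_of_le hx (Nat.mul_le_mul_right _ (hb m))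
        _ = 2 * k ^ m := by ring
        _ ≤ k * k ^ m := Nat.mul_le_mul_right _ hk
        _ = k ^ (m + 1) := (pow_succ' k m).symm
    · rcases Nat.lt_succ_iff_lt_or_eq.1 hi with him | rfl
      · obtain ⟨y, w, hy, hxy⟩ := h i him
        obtain ⟨c, rfl⟩ := Nat.exists_eq_add_of_lt him
        refine ⟨y, w + b (i + c + 1) * k ^ c, hy, ?_⟩
        rw [hxy]
        ring
      · exact ⟨x, 0, hx, by simp⟩

theorem nmul_nat (n x : ℕ) : @nmul ℕ (natStr k) n x = n * x := by
  induction n with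
  | zero => simp
  | succ n ih =>
    change x + @nmul ℕ (natStr k) n x = _
    rw [ih]
    ring

theorem realize_numeral_nat {β : Type} (w : β → ℕ) (n : ℕ) :
    @Term.realize LBA ℕ (natStr k).toStructure β w (numeral n) = n := by
  let _ := natStr k
  induction n with
  | zero => exact realize_zero w
  | succ n ih =>
    rw [numeral, realize_succ, ih]
    rfl

theorem isPow_nat_iff (hk : 2 ≤ k) {d : ℕ} : @IsPow ℕ (natStr k) d ↔ ∃ n, d = k ^ n := by
  change ((0 ≤ d ∧ 0 ≠ d) ∧ vVal k d = d) ↔ _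
  constructor
  · rintro ⟨⟨_, h₀⟩, h⟩
    obtain ⟨n, q, rfl, hq⟩ := exists_eq_pow_mul hk h₀.symm
    exact ⟨n, h.symm.trans (vVal_pow_mul hk n hq)⟩
  · rintro ⟨n, rfl⟩
    have h₀ : 0 < k ^ n := Nat.pow_pos (by omega)
    exact ⟨⟨h₀.le, h₀.ne⟩, vVal_pow hk n⟩

theorem digitEq_nat (hk : 2 ≤ k) {x y w i a : ℕ} (hy : y < k ^ i)
    (hx : x = y + a * k ^ i + k ^ (i + 1) * w) : @DigitEq ℕ (natStr k) x (k ^ i) a := by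
  refine ⟨(isPow_nat_iff hk).2 ⟨i, rfl⟩, y, hy.le, ⟨hy.le, hy.ne⟩, k ^ (i + 1) * w,
    (by omega : k ^ (i + 1) * w ≤ x), ?_, ?_⟩
  · rw [nmul_nat]
    exact hx
  · change _ ∨ k ^ i ≤ vVal k (k ^ (i + 1) * w) ∧ k ^ i ≠ vVal k (k ^ (i + 1) * w)
    rcases eq_or_ne (k ^ (i + 1) * w) 0 with h | h
    · exact Or.inl h
    · have h₁ := pow_le_vVal hk h (dvd_mul_right _ _)
      have h₂ : k ^ i < k ^ (i + 1) := Nat.pow_lt_pow_right (by omega) (by omega)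
      exact Or.inr ⟨by omega, by omega⟩

/-- The standard structure is a model of `T_k`. -/
theorem std_realize (hk : 2 ≤ k) {φ : LBA.Sentence} (h : IsAxiom k φ) : Std k ⊨ φ := by
  change @Sentence.Realize LBA ℕ (natStr k).toStructure φ
  let _ := natStr k
  cases h
  case comp φ hφ =>
    rw [realize_comp]
    intro p d hd
    obtain ⟨m, rfl⟩ := (isPow_nat_iff hk).1 hd
    classical
    obtain ⟨x, hx, h⟩ := exists_digits hk
      (fun i => if φ.Realize (Fin.cons (k ^ i) p : Fin _ → ℕ) then 1 else 0)
      (fun i => by split_ifs <;> omega) m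
    refine ⟨x, ⟨hx.le, hx.ne⟩, ?_⟩
    rintro e ⟨hle, hne⟩ he
    obtain ⟨i, rfl⟩ := (isPow_nat_iff hk).1 he
    have him : i < m := (Nat.pow_lt_pow_iff_right (by omega)).1 (lt_of_le_of_ne hle hne)
    obtain ⟨y, w, hy, hxy⟩ := h i him
    have hdig := digitEq_nat hk hy hxy
    by_cases hφi : φ.Realize (Fin.cons (k ^ i) p : Fin _ → ℕ)
    · rw [if_pos hφi] at hdig
      exact Or.inl ⟨hdig, hφi⟩
    · rw [if_neg hφi] at hdig
      exact Or.inr ⟨hdig, hφi⟩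
  -- the simplifier turns the other axioms into statements about natural numbers, and settles the
  -- simplest of them
  all_goals simp only [Sentence.Realize, BoundedFormula.realize_alls, ← FinVec.forall_iff,
    FinVec.Forall]
  all_goals simp [numeral, realize_modEq, realize_numeral_nat, nmul_nat]
  case add_assoc => exact Nat.add_assoc
  case add_comm => exact Nat.add_comm
  case le_antisymm => exact fun _ _ => Nat.le_antisymm
  case le_trans => exact fun _ _ _ => Nat.le_trans
  case le_total => exact Nat.le_total
  case succ_eq => exact fun _ => rfl
  case lt_iff_succ_le =>
    intro x y
    change x ≤ y ∧ x ≠ y ↔ x + 1 ≤ y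
    omega
  case ord1 =>
    exact fun x y => ⟨fun h => ⟨y - x, Nat.sub_le _ _, Nat.sub_add_cancel h⟩,
      fun ⟨z, _, hz⟩ => hz ▸ Nat.le_add_left x z⟩
  case mod =>
    exact fun x => ⟨x % k, Nat.mod_lt _ (by omega), x / k,
      (Nat.div_le_self _ _).trans (Nat.le_add_right _ _), Or.inl (Nat.mod_add_div x k).symm⟩
  case v0_zero => exact vVal_zero k
  case v0_one => exact vVal_pow hk 0
  case v1_mul => exact vVal_mul_self hk
  case v1_pow =>
    intro x hx a ha hak
    obtain ⟨n, rfl⟩ := (isPow_nat_iff hk).1 hx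
    exact vVal_mul_pow hk n ha (by omega)
  case v2 =>
    exact fun x y hx hy h h' => vVal_add hk (Ne.symm hx) (Ne.symm hy) (lt_of_le_of_ne h h')
  case v3 =>
    intro x hx
    have h := exists_last_digit hk (Ne.symm hx)
    rwa [show 1 + (k - 1) = k by omega]
  case v4 =>
    intro x hx
    refine ⟨k ^ Nat.log k x, Nat.pow_log_le_self k (Ne.symm hx), (isPow_nat_iff hk).2 ⟨_, rfl⟩,
      Nat.pow_log_le_self k (Ne.symm hx), ?_⟩
    have h := Nat.lt_pow_succ_log_self (show 1 < k by omega) x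
    rw [Nat.succ_eq_add_one, pow_succ'] at h
    exact ⟨h.le, h.ne⟩
  case v5 => exact vVal_vVal hk

end Standard

end BuchiArithmetic

theorem mainTheorem1 (k : ℕ) (hk : 2 ≤ k) :
    BuchiArithmetic.Axiomatizes (BuchiArithmetic.T k) (BuchiArithmetic.BA k) ∧
      ∃ U : BuchiArithmetic.LBA.Theory,
        (∀ ψ ∈ U, BuchiArithmetic.IsPi1 ψ) ∧
          BuchiArithmetic.Axiomatizes U (BuchiArithmetic.BA k) := by
  have h : BuchiArithmetic.Axiomatizes (BuchiArithmetic.T k) (BuchiArithmetic.BA k) := by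
    intro φ
    have hne : Nonempty (BuchiArithmetic.Std k) := ⟨(0 : ℕ)⟩
    have hstd : BuchiArithmetic.Std k ⊨ BuchiArithmetic.T k :=
      ⟨fun ψ hψ => BuchiArithmetic.std_realize hk hψ⟩
    change _ ↔ BuchiArithmetic.Std k ⊨ φ
    refine ⟨fun h => h.realize_sentence (BuchiArithmetic.Std k), fun h => ?_⟩
    rw [FirstOrder.Language.Theory.models_sentence_iff]
    intro M
    obtain ⟨B, hB, hBS⟩ := BuchiArithmetic.exists_buchiModel (k := k) (M := M) inferInstance
      fun ψ hψ => FirstOrder.Language.Theory.realize_sentence_of_mem (BuchiArithmetic.T k) hψ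
    obtain ⟨C, hC, hCS⟩ := BuchiArithmetic.exists_buchiModel (k := k)
      (BuchiArithmetic.stdStructure k) fun ψ hψ => BuchiArithmetic.std_realize hk hψ
    have key := BuchiArithmetic.realize_iff_realize hk φ (BuchiArithmetic.Std k) M
    rw [hBS, hCS] at key
    exact key.1 h
  exact ⟨h, BuchiArithmetic.T k, fun ψ hψ => BuchiArithmetic.IsAxiom.isPi1 hψ, h⟩
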